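/- Let $\mathbb{G}$ be a stratified Lie group, i.e. a connected, simply connected Lie group whose Lie algebra is a direct sum $\mathcal{G}=V_1\oplus\cdots\oplus V_m$ with $[V_1,V_j]=V_{j+1}$ for $1\le j\le m-1$ and $[V_1,V_m]=0$, $V_m\neq 0$. Let $Q=\sum_{j=1}^m j\dim V_j$ be its homogeneous dimension, and for $r>0$ let $\delta_r$ be the smooth automorphism of $\mathbb{G}$ whose differential at the identity $e$ is $\sum_k X_k\mapsto\sum_k r^kX_k$ ($X_k\in V_k$). Let $\rho:\mathbb{G}\to[0,\infty)$ be a homogeneous norm: $\rho$ is continuous, $C^\infty$ away from $e$, $\rho(x)=0$ if and only if $x=e$, $\rho(x^{-1})=\rho(x)$ and $\rho(\delta_r x)=r\rho(x)$. Balls are the sets $B(x,r)=\{y:\rho(y^{-1}x)<r\}$, $r>0$, and $|\cdot|$ and $dx$ denote Haar measure, to which the spaces $L^p(\mathbb{G})$ refer. For locally integrable $f$ put $$M_\alpha f(x)=\sup_{B\ni x}\frac1{|B|^{1-\alpha/Q}}\int_B|f(y)|\,dy,\qquad M_{\alpha,B_0}f(x)=\sup_{x\in B\subset B_0}\frac1{|B|^{1-\alpha/Q}}\int_B|f(y)|\,dy,$$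 the suprema being over balls $B$ ($B_0$ is a fixed ball), and $$[b,M_\alpha]f(x)=b(x)M_\alpha f(x)-M_\alpha(bf)(x).$$ Here $M_\alpha(bf)$ is defined by the same formula, with values in $[0,\infty]$, also when $bf$ is not locally integrable. We say that $[b,M_\alpha]$ is bounded from $L^p(\mathbb{G})$ to $L^q(\mathbb{G})$ if there is a constant $C$ such that, for every $f\in L^p(\mathbb{G})$, $M_\alpha f$ and $M_\alpha(bf)$ are finite almost everywhere and $\|[b,M_\alpha]f\|_{L^q}\le C\|f\|_{L^p}$. A function $b$ belongs to $\dot\Lambda_\beta(\mathbb{G})$ if there is $C>0$ with $|b(x)-b(y)|\le C\rho(y^{-1}x)^\beta$ for all $x,y\in\mathbb{G}$. **Theorem 1.2.** Let $0<\beta<1$, $0<\alpha<Q$, $0<\alpha+\beta<Q$, and let $b:\mathbb{G}\to\mathbb{R}$ be locally integrable. Then the following statements are equivalent: 1. $b\in\dot\Lambda_\beta(\mathbb{G})$ and $b\ge0$, that is, $b$ agrees almost everywhere with a nonnegative function in $\dot\Lambda_\beta(\mathbb{G})$. 2. $[b,M_\alpha]$ is bounded from $L^p(\mathbb{G})$ to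 $L^q(\mathbb{G})$ for all $p,q$ with $1<p<\frac{Q}{\alpha+\beta}$ and $\frac1q=\frac1p-\frac{\alpha+\beta}{Q}$. 3. $[b,M_\alpha]$ is bounded from $L^p(\mathbb{G})$ to $L^q(\mathbb{G})$ for some $p,q$ with $1<p<\frac{Q}{\alpha+\beta}$ and $\frac1q=\frac1p-\frac{\alpha+\beta}{Q}$. 4. There exists $s\in[1,\infty)$ such that $$\sup_B\frac1{|B|^{\beta/Q}}\Big(\frac1{|B|}\int_B\big|b(x)-|B|^{-\alpha/Q}M_{\alpha,B}(b)(x)\big|^s\,dx\Big)^{1/s}<\infty,\qquad(*)$$ the supremum being over all balls $B\subset\mathbb{G}$. 5. Condition $(*)$ holds for all $s\in[1,\infty)$. -/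

import Mathlib

open MeasureTheory
open scoped Manifold ContDiff ENNReal NNReal

noncomputable section

/-- A smooth Lie group is in particular of the smoothness class for which Mathlib puts a Lie algebra
structure on the tangent space at the identity. -/
instance lieGroupMinSmoothness {n : ℕ} {G : Type*} [TopologicalSpace G]
    [ChartedSpace (EuclideanSpace ℝ (Fin n)) G] [Group G] [LieGroup (𝓡 n) ∞ G] :
    LieGroup (𝓡 n) (minSmoothness ℝ 3) G :=
  LieGroup.of_le (n := ∞) (by
    rw [minSmoothness_of_isRCLikeNormedField]
    exact WithTop.coe_le_coe.2 (le_top : (3 : ℕ∞) ≤ ⊤))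

/-- A stratification of a real Lie algebra: a vector space decomposition
`𝔤 = V₁ ⊕ ⋯ ⊕ V_m` with `[V₁, V_j] = V_{j+1}` for `1 ≤ j ≤ m - 1` and `[V₁, V_j] = 0` for `j ≥ m`,
where `m` is the step. The layers are indexed by `ℕ`, those outside `1, …, m` being zero. -/
structure LieStratification (𝔤 : Type*) [LieRing 𝔤] [LieAlgebra ℝ 𝔤] where
  /-- the number `m` of layers -/
  step : ℕ
  /-- the layers `V_j` -/
  layer : ℕ → Submodule ℝ 𝔤
  isInternal : DirectSum.IsInternal layer
  layer_eq_bot : ∀ j, j ∉ Finset.Icc 1 step → layer j = ⊥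
  layer_step_ne_bot : layer step ≠ ⊥
  span_bracket : ∀ j, 1 ≤ j →
    Submodule.span ℝ {Z : 𝔤 | ∃ X ∈ layer 1, ∃ Y ∈ layer j, ⁅X, Y⁆ = Z} = layer (j + 1)

/-- The homogeneous dimension `Q = ∑_{j=1}^m j dim V_j`. -/
def LieStratification.homDim {𝔤 : Type*} [LieRing 𝔤] [LieAlgebra ℝ 𝔤]
    (S : LieStratification 𝔤) : ℕ :=
  ∑ j ∈ Finset.Icc 1 S.step, j * Module.finrank ℝ (S.layer j)

section Group

variable {n : ℕ} {G : Type*} [TopologicalSpace G] [ChartedSpace (EuclideanSpace ℝ (Fin n)) G]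
  [Group G] [LieGroup (𝓡 n) ∞ G]

/-- `φ` is the dilation `δ_r` of the group: the smooth automorphism whose differential at the
identity is the dilation `∑ X_k ↦ ∑ r^k X_k` (`X_k ∈ V_k`) of the Lie algebra. On a connected group
there is at most one such `φ`, and on a simply connected one it exists for each `r > 0`. -/
def IsGroupDilation (S : LieStratification (GroupLieAlgebra (𝓡 n) G)) (r : ℝ) (φ : G ≃* G) : Prop :=
  ContMDiff (𝓡 n) (𝓡 n) ∞ φ ∧
    ∀ k, ∀ X ∈ S.layer k,
      (mfderiv (𝓡 n) (𝓡 n) φ (1 : G) X : EuclideanSpace ℝ (Fin n)) =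
        (r ^ k • X : EuclideanSpace ℝ (Fin n))

/-- A homogeneous norm on a stratified group: continuous, nonnegative, smooth away from the
identity, vanishing exactly at the identity, symmetric, and homogeneous of degree one under the
dilations. -/
structure IsHomogeneousNorm (S : LieStratification (GroupLieAlgebra (𝓡 n) G)) (ρ : G → ℝ) :
    Prop where
  continuous : Continuous ρ
  contMDiffOn : ContMDiffOn (𝓡 n) 𝓘(ℝ, ℝ) ∞ ρ {1}ᶜ
  nonneg : ∀ x, 0 ≤ ρ x
  eq_zero_iff : ∀ x, ρ x = 0 ↔ x = 1
  inv : ∀ x, ρ x⁻¹ = ρ x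
  dilation : ∀ r : ℝ, 0 < r → ∃ φ : G ≃* G, IsGroupDilation S r φ ∧ ∀ x, ρ (φ x) = r * ρ x

end Group

section Operators

variable {G : Type*} [Group G]

/-- The ball `B(x, r) = {y : ρ(y⁻¹ x) < r}`. -/
def gBall (ρ : G → ℝ) (x : G) (r : ℝ) : Set G := {y | ρ (y⁻¹ * x) < r}

/-- `b` satisfies `|b(x) - b(y)| ≤ C ρ(y⁻¹ x)^β` for some constant `C` and all `x`, `y`. -/
def MemLip (ρ : G → ℝ) (β : ℝ) (b : G → ℝ) : Prop :=
  ∃ C : ℝ, 0 < C ∧ ∀ x y, |b x - b y| ≤ C * ρ (y⁻¹ * x) ^ β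

variable [MeasurableSpace G]

/-- The fractional maximal function `M_α f(x) = sup_{B ∋ x} |B|^{-(1-α/Q)} ∫_B |f|`, with values in
`[0, ∞]`. -/
def fracMaximal (μ : Measure G) (ρ : G → ℝ) (Q α : ℝ) (f : G → ℝ) (x : G) : ℝ≥0∞ :=
  ⨆ (c : G) (r : ℝ) (_ : 0 < r) (_ : x ∈ gBall ρ c r),
    (∫⁻ y in gBall ρ c r, ‖f y‖ₑ ∂μ) / μ (gBall ρ c r) ^ (1 - α / Q)

/-- The fractional maximal function `M_{α,B₀} f(x)` with respect to `B₀`: the supremum is over the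
balls `B ∋ x` contained in `B₀`. -/
def localFracMaximal (μ : Measure G) (ρ : G → ℝ) (Q α : ℝ) (B₀ : Set G) (f : G → ℝ) (x : G) :
    ℝ≥0∞ :=
  ⨆ (c : G) (r : ℝ) (_ : 0 < r) (_ : x ∈ gBall ρ c r) (_ : gBall ρ c r ⊆ B₀),
    (∫⁻ y in gBall ρ c r, ‖f y‖ₑ ∂μ) / μ (gBall ρ c r) ^ (1 - α / Q)

/-- The nonlinear commutator `[b, M_α] f = b M_α f - M_α (b f)`, meaningful at the points where both
maximal functions are finite. -/
def maximalCommutator (μ : Measure G) (ρ : G → ℝ) (Q α : ℝ) (b f : G → ℝ) (x : G) : ℝ :=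
  b x * (fracMaximal μ ρ Q α f x).toReal - (fracMaximal μ ρ Q α (fun y => b y * f y) x).toReal

/-- `[b, M_α]` is bounded from `L^p` to `L^q`: for every `f ∈ L^p` it is defined almost everywhere,
belongs to `L^q`, and its norm is at most `C ‖f‖_p`, with `C` independent of `f`. -/
def CommutatorBounded (μ : Measure G) (ρ : G → ℝ) (Q α : ℝ) (b : G → ℝ) (p q : ℝ) : Prop :=
  ∃ C : ℝ≥0, ∀ f : G → ℝ, MemLp f (ENNReal.ofReal p) μ →
    (∀ᵐ x ∂μ, fracMaximal μ ρ Q α f x < ⊤ ∧ fracMaximal μ ρ Q α (fun y => b y * f y) x < ⊤) ∧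
    MemLp (maximalCommutator μ ρ Q α b f) (ENNReal.ofReal q) μ ∧
    eLpNorm (maximalCommutator μ ρ Q α b f) (ENNReal.ofReal q) μ
      ≤ C * eLpNorm f (ENNReal.ofReal p) μ

/-- The quantity
`|B|^{-β/Q} (|B|⁻¹ ∫_B |b(x) - |B|^{-α/Q} M_{α,B}(b)(x)|^s dx)^{1/s}`, with values in `[0, ∞]`. -/
def maximalOscillation (μ : Measure G) (ρ : G → ℝ) (Q α β s : ℝ) (b : G → ℝ) (B : Set G) : ℝ≥0∞ :=
  μ B ^ (-(β / Q)) *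
    ((μ B)⁻¹ * ∫⁻ x in B,
      ‖b x - (μ B).toReal ^ (-(α / Q)) * (localFracMaximal μ ρ Q α B b x).toReal‖ₑ ^ s ∂μ)
      ^ (1 / s)

/-- The oscillation condition: on every ball `B` the function `M_{α,B}(b)` is finite almost
everywhere, and the above quantity is bounded over all balls. -/
def OscillationCondition (μ : Measure G) (ρ : G → ℝ) (Q α β s : ℝ) (b : G → ℝ) : Prop :=
  (∀ (c : G) (r : ℝ), 0 < r →
    ∀ᵐ x ∂μ.restrict (gBall ρ c r), localFracMaximal μ ρ Q α (gBall ρ c r) b x < ⊤) ∧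
  (⨆ (c : G) (r : ℝ) (_ : 0 < r), maximalOscillation μ ρ Q α β s b (gBall ρ c r)) < ⊤

end Operators

end

noncomputable section

open Set Filter Topology

/-! The equivalence rests on two facts about `ρ`: a quasi-triangle inequality and the exact growth
|B(x,r)| = c r^Q. `IsAhlforsNorm` isolates them, and the harmonic analysis uses no Lie structure.

If b ≥ 0 is Lipschitz of order β, then on a ball B containing x it differs from b(x) by at most a
constant times |B|^(β/Q). This factor raises the order of the maximal function, so |[b, M_α] f| ≤ C
M_{α+β} f pointwise. The L^p to L^q bound for M_{α+β} follows from Hedberg's inequality and the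
Hardy-Littlewood theorem (`exists_lintegral_fracMaximal_rpow_le`). The same comparison bounds the
integrand of the oscillation condition pointwise, hence for every s.

Conversely, the commutator tested on the indicator of B and the oscillation condition each provide a
function N on B, with N at least the mean of |b| over B and with the mean of |b - N| of size O(r^β).
The positive part of (mean of |b|) - b is at most |b - N|. This controls both the mean oscillation
of b and the gap |b_B| - b_B (`integral_abs_sub_average_le`). Campanato's theorem
(`exists_ae_eq_memLip`) turns the first bound into a Lipschitz representative b', and letting r tend
to 0 in the second gives |b'| ≤ b'.

For a homogeneous norm, a strongly contracting dilation forces the balls to be relatively compact,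
and the quasi-triangle inequality follows by compactness and scaling. A dilation multiplies Haar
measure by some κ. Haar and Lebesgue measure are comparable on small symmetric sets in a chart at 1,
and iterating the dilation on shrinking balls washes out the comparison constants, so κ = |det| =
r^Q (`haar_factor_eq_det`, `det_dilation`). The exponential map is not used. -/

/-- A symmetric quasi-norm on a group, with quasi-triangle constant `K`, whose balls of radius `r`
have measure `c r ^ Q` and are contained in compact sets. -/
structure IsAhlforsNorm {G : Type*} [TopologicalSpace G] [Group G] [MeasurableSpace G]
    (μ : Measure G) (ρ : G → ℝ) (Q K c : ℝ) : Prop where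
  continuous : Continuous ρ
  nonneg : ∀ x, 0 ≤ ρ x
  eq_zero_iff : ∀ x, ρ x = 0 ↔ x = 1
  inv : ∀ x, ρ x⁻¹ = ρ x
  dim_pos : 0 < Q
  one_le : 1 ≤ K
  mul_le : ∀ x y, ρ (x * y) ≤ K * max (ρ x) (ρ y)
  const_pos : 0 < c
  measure_ball : ∀ x r, 0 < r → μ (gBall ρ x r) = ENNReal.ofReal (c * r ^ Q)
  subset_compact : ∀ x r, ∃ S, IsCompact S ∧ gBall ρ x r ⊆ S

lemma mem_gBall {G : Type*} [Group G] {ρ : G → ℝ} {x y : G} {r : ℝ} :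
    y ∈ gBall ρ x r ↔ ρ (y⁻¹ * x) < r := Iff.rfl

lemma gBall_mono {G : Type*} [Group G] {ρ : G → ℝ} {x : G} {r s : ℝ} (h : r ≤ s) :
    gBall ρ x r ⊆ gBall ρ x s := fun _ hy => lt_of_lt_of_le hy h

/-- Each ball contributes a term of this form to a maximal function, since balls are open. Maximal
functions are therefore lower semicontinuous, hence Borel, even for non-measurable f. -/
lemma lowerSemicontinuous_iSup_mem {X : Type*} [TopologicalSpace X] {s : Set X} (hs : IsOpen s)
    (a : ℝ≥0∞) : LowerSemicontinuous fun x => ⨆ _ : x ∈ s, a := by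
  classical
  have : (fun x => ⨆ _ : x ∈ s, a) = s.indicator fun _ => a := by
    ext x
    by_cases hx : x ∈ s <;> simp [hx]
  rw [this]
  exact hs.lowerSemicontinuous_indicator zero_le

/-! ### Balls of a quasi-norm and measurability of maximal functions. -/

namespace IsAhlforsNorm

variable {G : Type*} [TopologicalSpace G] [Group G] [MeasurableSpace G]
  {μ : Measure G} {ρ : G → ℝ} {Q K c : ℝ}

lemma K_pos (h : IsAhlforsNorm μ ρ Q K c) : 0 < K := zero_lt_one.trans_le h.one_le

lemma symm (h : IsAhlforsNorm μ ρ Q K c) (x y : G) : ρ (x⁻¹ * y) = ρ (y⁻¹ * x) := by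
  rw [← h.inv]; simp

lemma mem_comm (h : IsAhlforsNorm μ ρ Q K c) {x y : G} {r : ℝ} :
    y ∈ gBall ρ x r ↔ x ∈ gBall ρ y r := by
  rw [mem_gBall, mem_gBall, h.symm]

lemma mem_self (h : IsAhlforsNorm μ ρ Q K c) (x : G) {r : ℝ} (hr : 0 < r) : x ∈ gBall ρ x r := by
  rw [mem_gBall, inv_mul_cancel, (h.eq_zero_iff 1).2 rfl]; exact hr

lemma triangle (h : IsAhlforsNorm μ ρ Q K c) (x y z : G) :
    ρ (x⁻¹ * z) ≤ K * max (ρ (x⁻¹ * y)) (ρ (y⁻¹ * z)) := by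
  simpa using h.mul_le (x⁻¹ * y) (y⁻¹ * z)

lemma dist_lt (h : IsAhlforsNorm μ ρ Q K c) {x y z : G} {r s t : ℝ} (hxy : ρ (x⁻¹ * y) < r)
    (hyz : ρ (y⁻¹ * z) < s) (hr : K * r ≤ t) (hs : K * s ≤ t) : ρ (x⁻¹ * z) < t := by
  refine (h.triangle x y z).trans_lt ?_
  rcases max_cases (ρ (x⁻¹ * y)) (ρ (y⁻¹ * z)) with ⟨e, _⟩ | ⟨e, _⟩ <;> rw [e]
  · exact (mul_lt_mul_of_pos_left hxy h.K_pos).trans_le hr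
  · exact (mul_lt_mul_of_pos_left hyz h.K_pos).trans_le hs

lemma dist_lt_of_mem (h : IsAhlforsNorm μ ρ Q K c) {x y z : G} {r : ℝ} (hx : x ∈ gBall ρ z r)
    (hy : y ∈ gBall ρ z r) : ρ (y⁻¹ * x) < K * r :=
  h.dist_lt (mem_gBall.1 hy) (by rw [h.symm]; exact hx) le_rfl le_rfl

lemma measure_pos (h : IsAhlforsNorm μ ρ Q K c) (x : G) {r : ℝ} (hr : 0 < r) :
    0 < μ (gBall ρ x r) := by
  rw [h.measure_ball x r hr]
  have := h.const_pos
  simp only [ENNReal.ofReal_pos]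
  positivity

lemma measure_ne_zero (h : IsAhlforsNorm μ ρ Q K c) (x : G) {r : ℝ} (hr : 0 < r) :
    μ (gBall ρ x r) ≠ 0 := (h.measure_pos x hr).ne'

lemma measure_ne_top (h : IsAhlforsNorm μ ρ Q K c) (x : G) {r : ℝ} (hr : 0 < r) :
    μ (gBall ρ x r) ≠ ⊤ := by
  rw [h.measure_ball x r hr]
  exact ENNReal.ofReal_ne_top

lemma measure_rpow (h : IsAhlforsNorm μ ρ Q K c) (x : G) {r : ℝ} (hr : 0 < r) (s : ℝ) :
    μ (gBall ρ x r) ^ s = ENNReal.ofReal ((c * r ^ Q) ^ s) := by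
  have := h.const_pos
  rw [h.measure_ball x r hr, ENNReal.ofReal_rpow_of_pos (by positivity)]

lemma isOpen_gBall [IsTopologicalGroup G] (h : IsAhlforsNorm μ ρ Q K c) (x : G) (r : ℝ) :
    IsOpen (gBall ρ x r) :=
  isOpen_lt (h.continuous.comp (by fun_prop)) continuous_const

lemma measurableSet_gBall [IsTopologicalGroup G] [BorelSpace G] (h : IsAhlforsNorm μ ρ Q K c)
    (x : G) (r : ℝ) : MeasurableSet (gBall ρ x r) :=
  (h.isOpen_gBall x r).measurableSet

lemma lowerSemicontinuous_fracMaximal [IsTopologicalGroup G] (h : IsAhlforsNorm μ ρ Q K c)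
    (α : ℝ) (f : G → ℝ) : LowerSemicontinuous (fracMaximal μ ρ Q α f) := by
  unfold fracMaximal
  refine lowerSemicontinuous_iSup fun z => lowerSemicontinuous_iSup fun r =>
    lowerSemicontinuous_iSup fun _ => lowerSemicontinuous_iSup_mem (h.isOpen_gBall z r) _

lemma measurable_fracMaximal [IsTopologicalGroup G] [BorelSpace G]
    (h : IsAhlforsNorm μ ρ Q K c) (α : ℝ) (f : G → ℝ) : Measurable (fracMaximal μ ρ Q α f) :=
  (h.lowerSemicontinuous_fracMaximal α f).measurable

lemma measurable_localFracMaximal [IsTopologicalGroup G] [BorelSpace G]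
    (h : IsAhlforsNorm μ ρ Q K c) (α : ℝ) (B : Set G) (f : G → ℝ) :
    Measurable (localFracMaximal μ ρ Q α B f) := by
  refine LowerSemicontinuous.measurable ?_
  unfold localFracMaximal
  refine lowerSemicontinuous_iSup fun z => lowerSemicontinuous_iSup fun r =>
    lowerSemicontinuous_iSup fun _ => ?_
  by_cases hB : gBall ρ z r ⊆ B
  · simpa [hB] using lowerSemicontinuous_iSup_mem (h.isOpen_gBall z r) _
  · simpa [hB] using lowerSemicontinuous_const

end IsAhlforsNorm

section

variable {G : Type*} [Group G] [MeasurableSpace G] {μ : Measure G} {ρ : G → ℝ} {Q : ℝ}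

lemma le_fracMaximal (α : ℝ) (f : G → ℝ) {x z : G} {r : ℝ} (hr : 0 < r) (hx : x ∈ gBall ρ z r) :
    (∫⁻ y in gBall ρ z r, ‖f y‖ₑ ∂μ) / μ (gBall ρ z r) ^ (1 - α / Q) ≤ fracMaximal μ ρ Q α f x :=
  le_iSup₂_of_le z r (le_iSup₂_of_le hr hx le_rfl)

lemma fracMaximal_le {α : ℝ} {f : G → ℝ} {x : G} {a : ℝ≥0∞}
    (H : ∀ z r, 0 < r → x ∈ gBall ρ z r →
      (∫⁻ y in gBall ρ z r, ‖f y‖ₑ ∂μ) / μ (gBall ρ z r) ^ (1 - α / Q) ≤ a) :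
    fracMaximal μ ρ Q α f x ≤ a :=
  iSup₂_le fun z r => iSup₂_le fun hr hx => H z r hr hx

lemma lt_fracMaximal_iff {α : ℝ} {f : G → ℝ} {x : G} {a : ℝ≥0∞} :
    a < fracMaximal μ ρ Q α f x ↔ ∃ z r, 0 < r ∧ x ∈ gBall ρ z r ∧
      a < (∫⁻ y in gBall ρ z r, ‖f y‖ₑ ∂μ) / μ (gBall ρ z r) ^ (1 - α / Q) := by
  simp only [fracMaximal, lt_iSup_iff, exists_prop]

lemma fracMaximal_congr_ae {α : ℝ} {f g : G → ℝ} (hfg : f =ᵐ[μ] g) :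
    fracMaximal μ ρ Q α f = fracMaximal μ ρ Q α g := by
  have : ∀ z r, ∫⁻ y in gBall ρ z r, ‖f y‖ₑ ∂μ = ∫⁻ y in gBall ρ z r, ‖g y‖ₑ ∂μ := fun z r =>
    lintegral_congr_ae (ae_restrict_of_ae (hfg.mono fun y hy => by simp only [hy]))
  ext x
  simp only [fracMaximal, this]

lemma localFracMaximal_congr_ae {α : ℝ} {B : Set G} {f g : G → ℝ} (hfg : f =ᵐ[μ] g) :
    localFracMaximal μ ρ Q α B f = localFracMaximal μ ρ Q α B g := by
  have : ∀ z r, ∫⁻ y in gBall ρ z r, ‖f y‖ₑ ∂μ = ∫⁻ y in gBall ρ z r, ‖g y‖ₑ ∂μ := fun z r =>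
    lintegral_congr_ae (ae_restrict_of_ae (hfg.mono fun y hy => by simp only [hy]))
  ext x
  simp only [localFracMaximal, this]

lemma le_localFracMaximal (α : ℝ) (f : G → ℝ) {B : Set G} {x z : G} {r : ℝ} (hr : 0 < r)
    (hx : x ∈ gBall ρ z r) (hB : gBall ρ z r ⊆ B) :
    (∫⁻ y in gBall ρ z r, ‖f y‖ₑ ∂μ) / μ (gBall ρ z r) ^ (1 - α / Q) ≤
      localFracMaximal μ ρ Q α B f x :=
  le_iSup₂_of_le z r (le_iSup₂_of_le hr hx (le_iSup_of_le hB le_rfl))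

lemma localFracMaximal_le {α : ℝ} {f : G → ℝ} {B : Set G} {x : G} {a : ℝ≥0∞}
    (H : ∀ z r, 0 < r → x ∈ gBall ρ z r → gBall ρ z r ⊆ B →
      (∫⁻ y in gBall ρ z r, ‖f y‖ₑ ∂μ) / μ (gBall ρ z r) ^ (1 - α / Q) ≤ a) :
    localFracMaximal μ ρ Q α B f x ≤ a :=
  iSup₂_le fun z r => iSup₂_le fun hr hx => iSup_le fun hB => H z r hr hx hB

end

/-! ### The layer cake formula for functions with values in [0, ∞]. -/

section LayerCake

lemma lintegral_Ioi_rpow_indicator {p : ℝ} (hp : 0 < p) (u : ℝ≥0∞) :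
    ∫⁻ t in Ioi (0 : ℝ), ENNReal.ofReal (p * t ^ (p - 1)) *
      {t : ℝ | ENNReal.ofReal t < u}.indicator 1 t = u ^ p := by
  have key : ∀ a : ℝ, 0 ≤ a → ∫⁻ t in Ioi (0 : ℝ), ENNReal.ofReal (p * t ^ (p - 1)) *
      {t : ℝ | ENNReal.ofReal t < ENNReal.ofReal a}.indicator 1 t = ENNReal.ofReal a ^ p := by
    intro a ha
    -- For one finite value, this is the real-valued layer cake formula on a one-point space.
    have := lintegral_rpow_eq_lintegral_meas_lt_mul (Measure.dirac ()) (f := fun _ => a)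
      (Eventually.of_forall fun _ => ha) aemeasurable_const hp
    rw [lintegral_const, measure_univ, mul_one, ← ENNReal.ofReal_rpow_of_nonneg ha hp.le,
      ← lintegral_const_mul' _ _ ENNReal.ofReal_ne_top] at this
    rw [this]
    refine setLIntegral_congr_fun measurableSet_Ioi fun t ht => ?_
    have ht' : (0 : ℝ) < t := ht
    rw [ENNReal.ofReal_mul hp.le, mul_assoc]
    congr 1
    rw [mul_comm]
    congr 1
    by_cases hta : t < a
    · have : ENNReal.ofReal t < ENNReal.ofReal a :=
        (ENNReal.ofReal_lt_ofReal_iff_of_nonneg ht'.le).2 hta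
      simp [this, hta]
    · have : ¬ ENNReal.ofReal t < ENNReal.ofReal a := by
        rwa [ENNReal.ofReal_lt_ofReal_iff_of_nonneg ht'.le]
      simp [this, hta]
  rcases eq_or_ne u ⊤ with rfl | hu
  · rw [ENNReal.top_rpow_of_pos hp, eq_top_iff]
    have lim : Tendsto (fun n : ℕ => ENNReal.ofReal n ^ p) atTop (𝓝 (⊤ ^ p)) := by
      refine (ENNReal.continuous_rpow_const.tendsto ⊤).comp ?_
      simpa using ENNReal.tendsto_nat_nhds_top
    rw [ENNReal.top_rpow_of_pos hp] at lim
    refine le_of_tendsto' lim fun n => ?_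
    rw [← key n n.cast_nonneg]
    refine lintegral_mono fun t => ?_
    gcongr _ * ?_
    exact indicator_le_indicator_of_subset
      (fun t (ht : ENNReal.ofReal t < _) => show ENNReal.ofReal t < ⊤ from ht.trans_le le_top)
      (fun _ => zero_le) t
  · lift u to ℝ≥0 using hu
    simpa using key u u.coe_nonneg

/-- Tonelli applied to the region below the graph of g. The value ∞ must be allowed because maximal
functions are not known in advance to be finite. -/
lemma lintegral_rpow_eq_lintegral_measure_lt {X : Type*} [MeasurableSpace X] {μ : Measure X}
    [SFinite μ] {g : X → ℝ≥0∞} (hg : Measurable g) {p : ℝ} (hp : 0 < p) :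
    ∫⁻ x, g x ^ p ∂μ = ∫⁻ t in Ioi (0 : ℝ), ENNReal.ofReal (p * t ^ (p - 1)) *
      μ {x | ENNReal.ofReal t < g x} := by
  have hS : MeasurableSet {z : X × ℝ | ENNReal.ofReal z.2 < g z.1} :=
    measurableSet_lt (by fun_prop) (by fun_prop)
  calc ∫⁻ x, g x ^ p ∂μ
      = ∫⁻ x, (∫⁻ t in Ioi (0 : ℝ), ENNReal.ofReal (p * t ^ (p - 1)) *
          {z : X × ℝ | ENNReal.ofReal z.2 < g z.1}.indicator 1 (x, t)) ∂μ := by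
        refine lintegral_congr fun x => ?_
        rw [← lintegral_Ioi_rpow_indicator hp (g x)]
        rfl
    _ = ∫⁻ t in Ioi (0 : ℝ), ∫⁻ x, ENNReal.ofReal (p * t ^ (p - 1)) *
          {z : X × ℝ | ENNReal.ofReal z.2 < g z.1}.indicator 1 (x, t) ∂μ := by
        refine lintegral_lintegral_swap (Measurable.aemeasurable ?_)
        exact Measurable.mul (by fun_prop) (measurable_one.indicator hS)
    _ = _ := by
        refine lintegral_congr fun t => ?_
        rw [lintegral_const_mul' _ _ ENNReal.ofReal_ne_top]
        congr 1
        have : MeasurableSet {x | ENNReal.ofReal t < g x} := measurableSet_lt (by fun_prop) hg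
        rw [← lintegral_indicator_one this]
        rfl

end LayerCake

/-! ### The Hardy-Littlewood maximal theorem. -/

namespace IsAhlforsNorm

variable {G : Type*} [TopologicalSpace G] [Group G] [IsTopologicalGroup G]
  [SecondCountableTopology G] [MeasurableSpace G] [BorelSpace G]
  {μ : Measure G} {ρ : G → ℝ} {Q K c : ℝ}

/-- The weak type `(1, 1)` inequality for the Hardy-Littlewood maximal function. -/
theorem mul_measure_lt_fracMaximal_zero_le (h : IsAhlforsNorm μ ρ Q K c) (f : G → ℝ) {t : ℝ}
    (ht : 0 < t) :
    ENNReal.ofReal t * μ {x | ENNReal.ofReal t < fracMaximal μ ρ Q 0 f x} ≤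
      ENNReal.ofReal ((2 * K ^ 2) ^ Q) * ∫⁻ y, ‖f y‖ₑ ∂μ := by
  have hK := h.K_pos
  have hc := h.const_pos
  have hQ := h.dim_pos
  set I := ∫⁻ y, ‖f y‖ₑ ∂μ with hI
  rcases eq_or_ne I ⊤ with hIt | hIt
  · have : (0 : ℝ) < (2 * K ^ 2) ^ Q := by positivity
    rw [hIt, ENNReal.mul_top (by simpa using this)]
    exact le_top
  let T : Set (G × ℝ) := {i | 0 < i.2 ∧
    ENNReal.ofReal t * μ (gBall ρ i.1 i.2) < ∫⁻ y in gBall ρ i.1 i.2, ‖f y‖ₑ ∂μ}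
  have hT : {x | ENNReal.ofReal t < fracMaximal μ ρ Q 0 f x} ⊆ ⋃ i ∈ T, gBall ρ i.1 i.2 := by
    intro x hx
    obtain ⟨z, r, hr, hxz, hlt⟩ := lt_fracMaximal_iff.1 hx
    rw [zero_div, sub_zero, ENNReal.rpow_one,
      ENNReal.lt_div_iff_mul_lt (Or.inl (h.measure_ne_zero z hr))
        (Or.inl (h.measure_ne_top z hr))] at hlt
    exact mem_biUnion (show (z, r) ∈ T from ⟨hr, hlt⟩) hxz
  -- Vitali selection needs bounded radii: a ball on which the mean of |f| exceeds t satisfies t c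
  -- r^Q < ‖f‖₁.
  obtain ⟨u, huT, hud, hu⟩ := Vitali.exists_disjoint_subfamily_covering_enlargement
    (fun i : G × ℝ => gBall ρ i.1 i.2) T (fun i => i.2) 2 one_lt_two (fun i hi => hi.1.le)
    ((I.toReal / (t * c)) ^ (1 / Q)) (by
      rintro ⟨z, r⟩ ⟨hr, hlt⟩
      simp only at hr hlt ⊢
      have h1 : ENNReal.ofReal t * μ (gBall ρ z r) < I := hlt.trans_le (setLIntegral_le_lintegral _ _)
      rw [h.measure_ball z r hr, ← ENNReal.ofReal_mul ht.le, ENNReal.ofReal_lt_iff_lt_toReal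
        (by positivity) hIt] at h1
      have h2 : r ^ Q ≤ I.toReal / (t * c) := by
        rw [le_div_iff₀ (by positivity)]
        linarith
      calc r = (r ^ Q) ^ (1 / Q) := by
            rw [← Real.rpow_mul hr.le, mul_one_div_cancel hQ.ne', Real.rpow_one]
        _ ≤ _ := by gcongr)
    (fun i hi => ⟨i.1, h.mem_self i.1 hi.1⟩)
  have hcount : u.Countable := hud.countable_of_isOpen (fun i _ => h.isOpen_gBall _ _)
    (fun i hi => ⟨i.1, h.mem_self i.1 (huT hi).1⟩)
  have hcover : {x | ENNReal.ofReal t < fracMaximal μ ρ Q 0 f x} ⊆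
      ⋃ i ∈ u, gBall ρ i.1 (2 * K ^ 2 * i.2) := by
    intro x hx
    obtain ⟨i, hi, hxi⟩ := mem_iUnion₂.1 (hT hx)
    obtain ⟨j, hj, ⟨w, hwi, hwj⟩, hij⟩ := hu i hi
    refine mem_biUnion hj ?_
    have hj0 := (huT hj).1
    -- The path from x to a common point w and on to the centre of the selected ball uses the
    -- quasi-triangle inequality twice. With radius ratio at most 2 this gives the enlargement 2 K².
    have h1 : ρ (x⁻¹ * w) < K * i.2 := h.dist_lt_of_mem hwi hxi
    refine h.dist_lt h1 (mem_gBall.1 hwj) ?_ ?_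
    · nlinarith [mul_le_mul_of_nonneg_left hij (sq_nonneg K)]
    · have := h.one_le
      nlinarith [mul_pos hK hj0, mul_le_mul_of_nonneg_right h.one_le (mul_pos hK hj0).le]
  have hball : ∀ i ∈ u, ENNReal.ofReal t * μ (gBall ρ i.1 (2 * K ^ 2 * i.2)) ≤
      ENNReal.ofReal ((2 * K ^ 2) ^ Q) * ∫⁻ y in gBall ρ i.1 i.2, ‖f y‖ₑ ∂μ := by
    intro i hi
    obtain ⟨hi0, hlt⟩ := huT hi
    rw [h.measure_ball _ _ (by positivity), Real.mul_rpow (by positivity) hi0.le, ← mul_assoc,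
      mul_comm c, mul_assoc, ENNReal.ofReal_mul (by positivity), ← h.measure_ball i.1 i.2 hi0,
      mul_left_comm]
    gcongr
  calc ENNReal.ofReal t * μ {x | ENNReal.ofReal t < fracMaximal μ ρ Q 0 f x}
      ≤ ENNReal.ofReal t * ∑' i : u, μ (gBall ρ i.1.1 (2 * K ^ 2 * i.1.2)) := by
        gcongr
        exact (measure_mono hcover).trans (measure_biUnion_le μ hcount _)
    _ = ∑' i : u, ENNReal.ofReal t * μ (gBall ρ i.1.1 (2 * K ^ 2 * i.1.2)) :=
        ENNReal.tsum_mul_left.symm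
    _ ≤ ∑' i : u, ENNReal.ofReal ((2 * K ^ 2) ^ Q) * ∫⁻ y in gBall ρ i.1.1 i.1.2, ‖f y‖ₑ ∂μ :=
        ENNReal.tsum_le_tsum fun i => hball i.1 i.2
    _ = ENNReal.ofReal ((2 * K ^ 2) ^ Q) * ∑' i : u, ∫⁻ y in gBall ρ i.1.1 i.1.2, ‖f y‖ₑ ∂μ :=
        ENNReal.tsum_mul_left
    _ ≤ _ := by
        gcongr
        rw [← lintegral_biUnion hcount (fun i _ => h.measurableSet_gBall _ _) hud]
        exact setLIntegral_le_lintegral _ _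

/-- Truncation improves the weak type inequality. -/
lemma mul_measure_lt_fracMaximal_zero_le_truncate (h : IsAhlforsNorm μ ρ Q K c) {f : G → ℝ}
    (hf : Measurable f) {t : ℝ} (ht : 0 < t) :
    ENNReal.ofReal t * μ {x | ENNReal.ofReal t < fracMaximal μ ρ Q 0 f x} ≤
      ENNReal.ofReal (2 * (2 * K ^ 2) ^ Q) *
        ∫⁻ y, ‖f y‖ₑ * {y | ENNReal.ofReal t < 2 * ‖f y‖ₑ}.indicator 1 y ∂μ := by
  set S := {y | ENNReal.ofReal t < 2 * ‖f y‖ₑ} with hS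
  have hSm : MeasurableSet S := measurableSet_lt (by fun_prop) (by fun_prop)
  have ht2 : ENNReal.ofReal t = 2 * ENNReal.ofReal (t / 2) := by
    rw [← ENNReal.ofReal_ofNat, ← ENNReal.ofReal_mul (by norm_num)]
    congr 1; ring
  -- The part of f with |f| ≤ t/2 adds at most t/2 to any mean, so a mean above t leaves more than
  -- t/2 to the truncated function.
  have hsub : {x | ENNReal.ofReal t < fracMaximal μ ρ Q 0 f x} ⊆
      {x | ENNReal.ofReal (t / 2) < fracMaximal μ ρ Q 0 (S.indicator f) x} := by
    intro x hx
    obtain ⟨z, r, hr, hxz, hlt⟩ := lt_fracMaximal_iff.1 hx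
    refine lt_fracMaximal_iff.2 ⟨z, r, hr, hxz, ?_⟩
    rw [zero_div, sub_zero, ENNReal.rpow_one,
      ENNReal.lt_div_iff_mul_lt (Or.inl (h.measure_ne_zero z hr))
        (Or.inl (h.measure_ne_top z hr))] at hlt ⊢
    have h1 : ∫⁻ y in gBall ρ z r, ‖f y‖ₑ ∂μ ≤
        ∫⁻ y in gBall ρ z r, ‖S.indicator f y‖ₑ ∂μ +
          ENNReal.ofReal (t / 2) * μ (gBall ρ z r) := by
      rw [← setLIntegral_const, ← lintegral_add_right _ measurable_const]
      refine lintegral_mono fun y => ?_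
      by_cases hy : y ∈ S
      · simp [hy]
      · have : 2 * ‖f y‖ₑ ≤ 2 * ENNReal.ofReal (t / 2) := by rw [← ht2]; exact not_lt.1 hy
        simpa [hy] using (ENNReal.mul_le_mul_iff_right two_ne_zero ENNReal.ofNat_ne_top).1 this
    have h2 := hlt.trans_le h1
    rw [ht2, two_mul, add_mul] at h2
    exact lt_of_add_lt_add_right h2
  have h1 : ∫⁻ y, ‖S.indicator f y‖ₑ ∂μ = ∫⁻ y, ‖f y‖ₑ * S.indicator 1 y ∂μ := by
    refine lintegral_congr fun y => ?_
    by_cases hy : y ∈ S <;> simp [hy]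
  rw [← h1, ENNReal.ofReal_mul zero_le_two, ENNReal.ofReal_ofNat, mul_assoc]
  nth_rewrite 1 [ht2]
  rw [mul_assoc]
  gcongr 2 * ?_
  exact (mul_le_mul_right (measure_mono hsub) _).trans
    (h.mul_measure_lt_fracMaximal_zero_le (S.indicator f) (half_pos ht))

/-- The Hardy-Littlewood maximal function is bounded on `L^p` for `p > 1`. -/
theorem lintegral_fracMaximal_zero_rpow_le [SFinite μ] (h : IsAhlforsNorm μ ρ Q K c) {p : ℝ}
    (hp : 1 < p) {f : G → ℝ} (hf : AEStronglyMeasurable f μ) :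
    ∫⁻ x, fracMaximal μ ρ Q 0 f x ^ p ∂μ ≤
      ENNReal.ofReal (p / (p - 1) * (2 * (2 * K ^ 2) ^ Q) * 2 ^ (p - 1)) *
        ∫⁻ x, ‖f x‖ₑ ^ p ∂μ := by
  wlog hfm : Measurable f generalizing f
  · have hae := hf.ae_eq_mk
    have e : ∫⁻ x, ‖f x‖ₑ ^ p ∂μ = ∫⁻ x, ‖hf.mk f x‖ₑ ^ p ∂μ :=
      lintegral_congr_ae (hae.mono fun x hx => by simp only [hx])
    rw [fracMaximal_congr_ae hae, e]
    exact this (f := hf.mk f) hf.stronglyMeasurable_mk.aestronglyMeasurable hf.stronglyMeasurable_mk.measurable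
  have hK := h.K_pos
  have hp1 : 0 < p - 1 := by linarith
  have hp0 : 0 < p := by linarith
  set A := 2 * (2 * K ^ 2) ^ Q with hA
  have hApos : 0 < A := by positivity
  have hS : MeasurableSet {z : G × ℝ | ENNReal.ofReal z.2 < 2 * ‖f z.1‖ₑ} :=
    measurableSet_lt (by fun_prop) (by fun_prop)
  -- Marcinkiewicz interpolation by hand: insert the truncated weak type bound into the layer cake
  -- formula and swap the integrals. Splitting off p/(p-1) leaves the weight (p-1) t^(p-2), so the
  -- inner integral is the layer cake of 2|f| with exponent p-1.
  calc ∫⁻ x, fracMaximal μ ρ Q 0 f x ^ p ∂μ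
      = ∫⁻ t in Ioi (0 : ℝ), ENNReal.ofReal (p * t ^ (p - 1)) *
          μ {x | ENNReal.ofReal t < fracMaximal μ ρ Q 0 f x} :=
        lintegral_rpow_eq_lintegral_measure_lt (h.measurable_fracMaximal 0 f) hp0
    _ ≤ ∫⁻ t in Ioi (0 : ℝ), ∫⁻ y, ENNReal.ofReal (p / (p - 1) * A) *
          (ENNReal.ofReal ((p - 1) * t ^ (p - 1 - 1)) * (‖f y‖ₑ *
            {z : G × ℝ | ENNReal.ofReal z.2 < 2 * ‖f z.1‖ₑ}.indicator 1 (y, t))) ∂μ := by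
        refine setLIntegral_mono' measurableSet_Ioi fun t ht => ?_
        have ht' : (0 : ℝ) < t := ht
        rw [lintegral_const_mul' _ _ ENNReal.ofReal_ne_top,
          lintegral_const_mul' _ _ ENNReal.ofReal_ne_top, ← mul_assoc,
          ← ENNReal.ofReal_mul (by positivity)]
        have e1 : p / (p - 1) * A * ((p - 1) * t ^ (p - 1 - 1)) = p * t ^ (p - 1 - 1) * A := by
          field_simp
        have e2 : p * t ^ (p - 1) = p * t ^ (p - 1 - 1) * t := by
          rw [Real.rpow_sub_one ht'.ne' (p - 1)]
          field_simp
        rw [e1, e2, ENNReal.ofReal_mul (p := p * t ^ (p - 1 - 1)) (q := t) (by positivity),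
          ENNReal.ofReal_mul (p := p * t ^ (p - 1 - 1)) (q := A) (by positivity),
          mul_assoc, mul_assoc]
        gcongr _ * ?_
        exact h.mul_measure_lt_fracMaximal_zero_le_truncate hfm ht'
    _ = ∫⁻ y, (∫⁻ t in Ioi (0 : ℝ), ENNReal.ofReal (p / (p - 1) * A) *
          (ENNReal.ofReal ((p - 1) * t ^ (p - 1 - 1)) * (‖f y‖ₑ *
            {z : G × ℝ | ENNReal.ofReal z.2 < 2 * ‖f z.1‖ₑ}.indicator 1 (y, t)))) ∂μ := by
        refine (lintegral_lintegral_swap (Measurable.aemeasurable ?_)).symm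
        refine Measurable.mul measurable_const (Measurable.mul (by fun_prop)
          (Measurable.mul (by fun_prop) (measurable_one.indicator hS)))
    _ = ∫⁻ y, ENNReal.ofReal (p / (p - 1) * A * 2 ^ (p - 1)) * ‖f y‖ₑ ^ p ∂μ := by
        refine lintegral_congr fun y => ?_
        have e3 := lintegral_Ioi_rpow_indicator hp1 (2 * ‖f y‖ₑ)
        simp_rw [mul_left_comm _ ‖f y‖ₑ]
        rw [lintegral_const_mul' _ _ enorm_ne_top,
          lintegral_const_mul' _ _ ENNReal.ofReal_ne_top, mul_left_comm]
        change _ * (_ * ∫⁻ t in Ioi (0 : ℝ), ENNReal.ofReal ((p - 1) * t ^ (p - 1 - 1)) *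
          {t : ℝ | ENNReal.ofReal t < 2 * ‖f y‖ₑ}.indicator 1 t) = _
        rw [e3, ENNReal.mul_rpow_of_nonneg _ _ hp1.le,
          ENNReal.ofReal_mul (p := p / (p - 1) * A) (by positivity),
          ← ENNReal.ofReal_rpow_of_pos zero_lt_two, ENNReal.ofReal_ofNat, mul_left_comm ‖f y‖ₑ,
          mul_assoc]
        congr 2
        conv_lhs => enter [1]; rw [← ENNReal.rpow_one ‖f y‖ₑ]
        rw [← ENNReal.rpow_add_of_nonneg _ _ zero_le_one hp1.le]
        congr 1; ring
    _ = _ := lintegral_const_mul' _ _ ENNReal.ofReal_ne_top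

end IsAhlforsNorm

/-! ### Fractional maximal functions from L^p to L^q. -/

lemma setLIntegral_enorm_le_eLpNorm_mul_rpow {X : Type*} [MeasurableSpace X] {μ : Measure X}
    {f : X → ℝ} (B : Set X) (hf : AEStronglyMeasurable f (μ.restrict B)) {p : ℝ} (hp : 1 ≤ p) :
    ∫⁻ x in B, ‖f x‖ₑ ∂μ ≤
      eLpNorm f (ENNReal.ofReal p) (μ.restrict B) * μ B ^ (1 - 1 / p) := by
  have := eLpNorm_le_eLpNorm_mul_rpow_measure_univ (p := 1) (q := ENNReal.ofReal p)
    (by simpa using hp) hf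
  rw [eLpNorm_one_eq_lintegral_enorm, Measure.restrict_apply_univ,
    ENNReal.toReal_ofReal (zero_le_one.trans hp)] at this
  simpa using this

lemma eLpNorm_ofReal_eq {X : Type*} [MeasurableSpace X] {μ : Measure X} (f : X → ℝ) {p : ℝ}
    (hp : 0 < p) : eLpNorm f (ENNReal.ofReal p) μ = (∫⁻ x, ‖f x‖ₑ ^ p ∂μ) ^ (1 / p) := by
  rw [eLpNorm_eq_lintegral_rpow_enorm_toReal (by simpa using hp) ENNReal.ofReal_ne_top,
    ENNReal.toReal_ofReal hp.le]

namespace IsAhlforsNorm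

variable {G : Type*} [TopologicalSpace G] [Group G]
  [MeasurableSpace G] {μ : Measure G} {ρ : G → ℝ} {Q K c : ℝ}

/-- Hedberg's pointwise inequality. -/
lemma fracMaximal_le_eLpNorm_mul (h : IsAhlforsNorm μ ρ Q K c) {γ p q : ℝ} (hp : 1 ≤ p)
    (hpq : p ≤ q) (hq : 1 / q = 1 / p - γ / Q) {f : G → ℝ} (hf : AEStronglyMeasurable f μ) (x : G) :
    fracMaximal μ ρ Q γ f x ≤
      eLpNorm f (ENNReal.ofReal p) μ ^ (1 - p / q) * fracMaximal μ ρ Q 0 f x ^ (p / q) := by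
  have hp0 : 0 < p := by linarith
  have hq0 : 0 < q := by linarith
  have hpq1 : p / q ≤ 1 := (div_le_one hq0).2 hpq
  have hpq0 : 0 ≤ p / q := by positivity
  refine fracMaximal_le fun z r hr hx => ?_
  refine le_trans ?_ (mul_le_mul_right
    (ENNReal.rpow_le_rpow (le_fracMaximal (Q := Q) (μ := μ) 0 f hr hx) hpq0) _)
  set N := eLpNorm f (ENNReal.ofReal p) μ
  have hH : ∫⁻ y in gBall ρ z r, ‖f y‖ₑ ∂μ ≤ N * μ (gBall ρ z r) ^ (1 - 1 / p) :=
    (setLIntegral_enorm_le_eLpNorm_mul_rpow _ hf.restrict hp).trans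
      (mul_le_mul_left (eLpNorm_mono_measure f Measure.restrict_le_self) _)
  set I := ∫⁻ y in gBall ρ z r, ‖f y‖ₑ ∂μ
  have hV0 := h.measure_ne_zero z hr
  have hVt := h.measure_ne_top z hr
  set V := μ (gBall ρ z r)
  -- Hölder is applied to the first factor only. The relation between p, q and γ makes the powers of
  -- the measure combine to -p/q, which turns the second factor into a mean raised to p/q.
  have hI : I = I ^ (1 - p / q) * I ^ (p / q) := by
    rw [← ENNReal.rpow_add_of_nonneg _ _ (by linarith) hpq0]; simp
  have hexp : (1 - 1 / p) * (1 - p / q) - (1 - γ / Q) = -(p / q) := by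
    have : γ / Q = 1 / p - 1 / q := by linarith
    rw [this]; field_simp; ring
  calc I / V ^ (1 - γ / Q) = I ^ (1 - p / q) * I ^ (p / q) * V ^ (-(1 - γ / Q)) := by
        rw [← hI, ENNReal.rpow_neg, div_eq_mul_inv]
    _ ≤ (N * V ^ (1 - 1 / p)) ^ (1 - p / q) * I ^ (p / q) * V ^ (-(1 - γ / Q)) := by
        gcongr
    _ = N ^ (1 - p / q) * (I ^ (p / q) * V ^ (-(p / q))) := by
        rw [ENNReal.mul_rpow_of_nonneg _ _ (by linarith), ← ENNReal.rpow_mul, ← hexp,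
          sub_eq_add_neg ((1 - 1 / p) * (1 - p / q)), ENNReal.rpow_add _ _ hV0 hVt]
        ring
    _ = _ := by
        rw [zero_div, sub_zero, ENNReal.rpow_one, ENNReal.div_rpow_of_nonneg _ _ hpq0,
          ENNReal.rpow_neg, ← div_eq_mul_inv]

/-- The fractional maximal function maps `L^p` to `L^q`. -/
theorem exists_lintegral_fracMaximal_rpow_le [IsTopologicalGroup G] [SecondCountableTopology G]
    [BorelSpace G] [SFinite μ] (h : IsAhlforsNorm μ ρ Q K c) {γ p q : ℝ} (hp : 1 < p)
    (hpq : p ≤ q) (hq : 1 / q = 1 / p - γ / Q) :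
    ∃ C : ℝ≥0, ∀ f : G → ℝ, AEStronglyMeasurable f μ →
      (∫⁻ x, fracMaximal μ ρ Q γ f x ^ q ∂μ) ^ (1 / q) ≤ C * eLpNorm f (ENNReal.ofReal p) μ := by
  have hp0 : 0 < p := by linarith
  have hq0 : 0 < q := by linarith
  set D := ENNReal.ofReal (p / (p - 1) * (2 * (2 * K ^ 2) ^ Q) * 2 ^ (p - 1)) with hD
  refine ⟨(D ^ (1 / q)).toNNReal, fun f hf => ?_⟩
  rw [ENNReal.coe_toNNReal (ENNReal.rpow_ne_top_of_nonneg (by positivity) ENNReal.ofReal_ne_top)]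
  set N := eLpNorm f (ENNReal.ofReal p) μ with hN
  have hNp : ∫⁻ x, ‖f x‖ₑ ^ p ∂μ = N ^ p := by
    rw [hN, eLpNorm_ofReal_eq f hp0, ← ENNReal.rpow_mul, one_div_mul_cancel hp0.ne',
      ENNReal.rpow_one]
  -- The q-th power of Hedberg's inequality contains the unfractional maximal function to the power
  -- p, exactly what the Hardy-Littlewood theorem integrates.
  have key : ∫⁻ x, fracMaximal μ ρ Q γ f x ^ q ∂μ ≤ D * N ^ q := by
    calc ∫⁻ x, fracMaximal μ ρ Q γ f x ^ q ∂μ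
        ≤ ∫⁻ x, N ^ (q - p) * fracMaximal μ ρ Q 0 f x ^ p ∂μ := by
          refine lintegral_mono fun x => ?_
          refine (ENNReal.rpow_le_rpow (h.fracMaximal_le_eLpNorm_mul hp.le hpq hq hf x)
            hq0.le).trans_eq ?_
          rw [ENNReal.mul_rpow_of_nonneg _ _ hq0.le, ← ENNReal.rpow_mul, ← ENNReal.rpow_mul,
            div_mul_cancel₀ _ hq0.ne', sub_mul, div_mul_cancel₀ _ hq0.ne', one_mul]
      _ = N ^ (q - p) * ∫⁻ x, fracMaximal μ ρ Q 0 f x ^ p ∂μ :=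
          lintegral_const_mul _ ((h.measurable_fracMaximal 0 f).pow_const p)
      _ ≤ N ^ (q - p) * (D * N ^ p) := by
          gcongr
          rw [← hNp]
          exact h.lintegral_fracMaximal_zero_rpow_le hp hf
      _ = D * N ^ q := by
          rw [mul_left_comm, ← ENNReal.rpow_add_of_nonneg _ _ (by linarith) hp0.le,
            sub_add_cancel]
  refine (ENNReal.rpow_le_rpow key (by positivity)).trans_eq ?_
  rw [ENNReal.mul_rpow_of_nonneg _ _ (by positivity), ← ENNReal.rpow_mul,
    mul_one_div_cancel hq0.ne', ENNReal.rpow_one]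

end IsAhlforsNorm

/-! ### Lipschitz symbols: commutator and oscillation estimates. -/

lemma ENNReal.enorm_toReal_sub_toReal_le {a d e : ℝ≥0∞} (ha : a ≠ ⊤) (hd : d ≠ ⊤)
    (had : a ≤ d + e) (hda : d ≤ a + e) : ‖a.toReal - d.toReal‖ₑ ≤ e := by
  rcases eq_or_ne e ⊤ with rfl | he
  · exact le_top
  lift a to ℝ≥0 using ha
  lift d to ℝ≥0 using hd
  lift e to ℝ≥0 using he
  rw [Real.enorm_eq_ofReal_abs, ← ENNReal.ofReal_coe_nnreal (p := e)]
  refine ENNReal.ofReal_le_ofReal (abs_sub_le_iff.2 ?_)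
  have h1 : (a : ℝ) ≤ d + e := by exact_mod_cast had
  have h2 : (d : ℝ) ≤ a + e := by exact_mod_cast hda
  simp only [ENNReal.coe_toReal]
  constructor <;> linarith

section Congr

variable {G : Type*} [Group G] [MeasurableSpace G] {μ : Measure G} {ρ : G → ℝ} {Q α β : ℝ}
  {b b' : G → ℝ}

lemma CommutatorBounded.congr_ae {p q : ℝ} (hbb : b =ᵐ[μ] b')
    (H : CommutatorBounded μ ρ Q α b' p q) : CommutatorBounded μ ρ Q α b p q := by
  obtain ⟨C, hC⟩ := H
  refine ⟨C, fun f hf => ?_⟩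
  have e1 : fracMaximal μ ρ Q α (fun y => b y * f y) = fracMaximal μ ρ Q α fun y => b' y * f y :=
    fracMaximal_congr_ae (hbb.mono fun y hy => by simp only [hy])
  have e2 : maximalCommutator μ ρ Q α b f =ᵐ[μ] maximalCommutator μ ρ Q α b' f :=
    hbb.mono fun y hy => by simp only [maximalCommutator, e1, hy]
  rw [e1, memLp_congr_ae e2, eLpNorm_congr_ae e2]
  exact hC f hf

lemma OscillationCondition.congr_ae {s : ℝ} (hbb : b =ᵐ[μ] b')
    (H : OscillationCondition μ ρ Q α β s b') : OscillationCondition μ ρ Q α β s b := by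
  have e : ∀ B, maximalOscillation μ ρ Q α β s b B = maximalOscillation μ ρ Q α β s b' B := by
    intro B
    unfold maximalOscillation
    congr 3
    refine lintegral_congr_ae (ae_restrict_of_ae (hbb.mono fun y hy => ?_))
    simp only [hy, localFracMaximal_congr_ae hbb]
  unfold OscillationCondition
  simp only [e, localFracMaximal_congr_ae hbb]
  exact H

end Congr

namespace IsAhlforsNorm

variable {G : Type*} [TopologicalSpace G] [Group G]
  [MeasurableSpace G] {μ : Measure G} {ρ : G → ℝ} {Q K c : ℝ}

lemma continuous_of_memLip [IsTopologicalGroup G] (h : IsAhlforsNorm μ ρ Q K c) {β : ℝ}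
    (hβ : 0 < β) {b : G → ℝ} (hb : MemLip ρ β b) : Continuous b := by
  obtain ⟨L, hL, hb⟩ := hb
  refine continuous_iff_continuousAt.2 fun x => ?_
  have h0 : Tendsto (fun y => L * ρ (x⁻¹ * y) ^ β) (𝓝 x) (𝓝 0) := by
    have hc : Continuous fun y => L * ρ (x⁻¹ * y) ^ β :=
      continuous_const.mul ((h.continuous.comp (by fun_prop)).rpow_const fun _ => Or.inr hβ.le)
    have := hc.tendsto x
    rwa [inv_mul_cancel, (h.eq_zero_iff 1).2 rfl, Real.zero_rpow hβ.ne', mul_zero] at this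
  refine tendsto_iff_dist_tendsto_zero.2 (squeeze_zero (fun _ => dist_nonneg) (fun y => ?_) h0)
  rw [Real.dist_eq]
  exact hb y x

/-- Two points of a ball of radius r are at distance less than K r. The growth c r^Q converts the
resulting Lipschitz gain into a power of the measure, the form that shifts the order of a maximal
function. -/
lemma ofReal_lip_eq (h : IsAhlforsNorm μ ρ Q K c) {L β : ℝ} (hL : 0 < L) (z : G) {r : ℝ}
    (hr : 0 < r) : ENNReal.ofReal (L * (K * r) ^ β) =
      ENNReal.ofReal (L * K ^ β * c ^ (-(β / Q))) * μ (gBall ρ z r) ^ (β / Q) := by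
  have hc := h.const_pos
  have hK := h.K_pos
  rw [h.measure_rpow z hr, ← ENNReal.ofReal_mul (by positivity),
    Real.mul_rpow hc.le (by positivity), ← Real.rpow_mul hr.le, mul_div_cancel₀ _ h.dim_pos.ne',
    Real.mul_rpow hK.le hr.le, Real.rpow_neg hc.le]
  congr 1
  have : c ^ (β / Q) ≠ 0 := by positivity
  field_simp

lemma enorm_le_add_of_mem (h : IsAhlforsNorm μ ρ Q K c) {L β : ℝ} (hβ : 0 < β) (hL : 0 < L)
    {b : G → ℝ} (hb : ∀ x y, |b x - b y| ≤ L * ρ (y⁻¹ * x) ^ β) {x y z : G} {r : ℝ}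
    (hx : x ∈ gBall ρ z r) (hy : y ∈ gBall ρ z r) :
    ‖b x‖ₑ ≤ ‖b y‖ₑ + ENNReal.ofReal (L * (K * r) ^ β) := by
  have h1 : |b x - b y| ≤ L * (K * r) ^ β := by
    refine (hb x y).trans ?_
    have := h.nonneg (y⁻¹ * x)
    have := (h.dist_lt_of_mem hx hy).le
    gcongr
  calc ‖b x‖ₑ = ‖b y + (b x - b y)‖ₑ := by congr 1; ring
    _ ≤ ‖b y‖ₑ + ‖b x - b y‖ₑ := enorm_add_le _ _
    _ ≤ _ := by
      gcongr
      rw [Real.enorm_eq_ofReal_abs]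
      exact ENNReal.ofReal_le_ofReal h1

lemma rpow_mul_div_rpow (h : IsAhlforsNorm μ ρ Q K c) (α β : ℝ) (z : G) {r : ℝ} (hr : 0 < r)
    (a : ℝ≥0∞) : μ (gBall ρ z r) ^ (β / Q) * a / μ (gBall ρ z r) ^ (1 - α / Q) =
      a / μ (gBall ρ z r) ^ (1 - (α + β) / Q) := by
  rw [div_eq_mul_inv (_ * a), div_eq_mul_inv a, ← ENNReal.rpow_neg, ← ENNReal.rpow_neg,
    mul_right_comm,
    ← ENNReal.rpow_add _ _ (h.measure_ne_zero z hr) (h.measure_ne_top z hr), mul_comm]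
  congr 2
  ring

lemma measure_div_rpow (h : IsAhlforsNorm μ ρ Q K c) (α : ℝ) (z : G) {r : ℝ} (hr : 0 < r) :
    μ (gBall ρ z r) / μ (gBall ρ z r) ^ (1 - α / Q) = μ (gBall ρ z r) ^ (α / Q) := by
  nth_rewrite 1 [← ENNReal.rpow_one (μ (gBall ρ z r))]
  rw [div_eq_mul_inv, ← ENNReal.rpow_neg,
    ← ENNReal.rpow_add _ _ (h.measure_ne_zero z hr) (h.measure_ne_top z hr)]
  congr 1
  ring

/-- On a ball containing x, |b(y)| ≤ |b(x)| + C |B|^(β/Q), and the extra power of |B| changes the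
order from α to α + β. The companion `mul_fracMaximal_le` exchanges the roles of x and y; it splits
an integral of a sum, which is where measurability of f enters. -/
lemma fracMaximal_mul_le (h : IsAhlforsNorm μ ρ Q K c) {L β : ℝ} (hβ : 0 < β) (hL : 0 < L)
    {b : G → ℝ} (hb : ∀ x y, |b x - b y| ≤ L * ρ (y⁻¹ * x) ^ β) [IsTopologicalGroup G]
    [BorelSpace G] (α : ℝ) (f : G → ℝ) (x : G) :
    fracMaximal μ ρ Q α (fun y => b y * f y) x ≤ ‖b x‖ₑ * fracMaximal μ ρ Q α f x +
      ENNReal.ofReal (L * K ^ β * c ^ (-(β / Q))) * fracMaximal μ ρ Q (α + β) f x := by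
  refine fracMaximal_le fun z r hr hx => ?_
  have h1 : ∫⁻ y in gBall ρ z r, ‖b y * f y‖ₑ ∂μ ≤
      (‖b x‖ₑ + ENNReal.ofReal (L * (K * r) ^ β)) * ∫⁻ y in gBall ρ z r, ‖f y‖ₑ ∂μ := by
    rw [← lintegral_const_mul' _ _ (by simp)]
    refine setLIntegral_mono' (h.measurableSet_gBall z r) fun y hy => ?_
    rw [enorm_mul]
    gcongr
    exact h.enorm_le_add_of_mem hβ hL hb hy hx
  refine (ENNReal.div_le_div_right h1 _).trans ?_
  rw [add_mul, ENNReal.add_div]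
  gcongr
  · rw [mul_div_assoc]
    gcongr
    exact le_fracMaximal α f hr hx
  · rw [h.ofReal_lip_eq hL z hr, mul_assoc, mul_div_assoc, h.rpow_mul_div_rpow α β z hr]
    gcongr
    exact le_fracMaximal _ f hr hx

lemma mul_fracMaximal_le (h : IsAhlforsNorm μ ρ Q K c) {L β : ℝ} (hβ : 0 < β) (hL : 0 < L)
    {b : G → ℝ} (hb : ∀ x y, |b x - b y| ≤ L * ρ (y⁻¹ * x) ^ β) [IsTopologicalGroup G]
    [BorelSpace G] (α : ℝ) {f : G → ℝ} (hf : AEStronglyMeasurable f μ) (x : G) :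
    ‖b x‖ₑ * fracMaximal μ ρ Q α f x ≤ fracMaximal μ ρ Q α (fun y => b y * f y) x +
      ENNReal.ofReal (L * K ^ β * c ^ (-(β / Q))) * fracMaximal μ ρ Q (α + β) f x := by
  conv_lhs => unfold fracMaximal
  simp only [ENNReal.mul_iSup]
  refine iSup₂_le fun z r => iSup₂_le fun hr hx => ?_
  have h1 : ‖b x‖ₑ * ∫⁻ y in gBall ρ z r, ‖f y‖ₑ ∂μ ≤ ∫⁻ y in gBall ρ z r, ‖b y * f y‖ₑ ∂μ +
      ENNReal.ofReal (L * (K * r) ^ β) * ∫⁻ y in gBall ρ z r, ‖f y‖ₑ ∂μ := by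
    rw [← lintegral_const_mul' _ _ (by simp), ← lintegral_const_mul' _ _ (by simp),
      ← lintegral_add_right' _ (hf.restrict.enorm.const_mul _)]
    refine setLIntegral_mono' (h.measurableSet_gBall z r) fun y hy => ?_
    rw [enorm_mul, ← add_mul]
    gcongr
    exact h.enorm_le_add_of_mem hβ hL hb hx hy
  rw [← mul_div_assoc]
  refine (ENNReal.div_le_div_right h1 _).trans ?_
  rw [ENNReal.add_div]
  gcongr
  · exact le_fracMaximal α (fun y => b y * f y) hr hx
  · rw [h.ofReal_lip_eq hL z hr, mul_assoc, mul_div_assoc, h.rpow_mul_div_rpow α β z hr]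
    gcongr
    exact le_fracMaximal _ f hr hx

lemma ae_fracMaximal_lt_top [IsTopologicalGroup G] [SecondCountableTopology G]
    [BorelSpace G] [SFinite μ] (h : IsAhlforsNorm μ ρ Q K c) {γ p : ℝ} (hp : 1 < p) (hγ : 0 ≤ γ)
    (hpγ : 0 < 1 / p - γ / Q) {f : G → ℝ} (hf : MemLp f (ENNReal.ofReal p) μ) :
    ∀ᵐ x ∂μ, fracMaximal μ ρ Q γ f x < ⊤ := by
  have hp0 : 0 < p := by linarith
  set q := (1 / p - γ / Q)⁻¹ with hq
  have hq0 : 0 < q := inv_pos.2 hpγ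
  have hq1 : 1 / q = 1 / p - γ / Q := by rw [hq, one_div, inv_inv]
  have hpq : p ≤ q := by
    rw [← one_div_le_one_div hq0 hp0, hq1]
    have := div_nonneg hγ h.dim_pos.le
    linarith
  obtain ⟨C, hC⟩ := h.exists_lintegral_fracMaximal_rpow_le hp hpq hq1
  have h1 : (∫⁻ x, fracMaximal μ ρ Q γ f x ^ q ∂μ) ^ (1 / q) < ⊤ :=
    (hC f hf.1).trans_lt (ENNReal.mul_lt_top ENNReal.coe_lt_top hf.2)
  have h2 : ∫⁻ x, fracMaximal μ ρ Q γ f x ^ q ∂μ ≠ ⊤ :=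
    ((ENNReal.rpow_lt_top_iff_of_pos (by positivity)).1 h1).ne
  filter_upwards [ae_lt_top ((h.measurable_fracMaximal γ f).pow_const q) h2] with x hx
  exact (ENNReal.rpow_lt_top_iff_of_pos hq0).1 hx

/-- Nonnegativity allows b(x) to be replaced by |b(x)|. The two one-sided comparisons then bound the
commutator pointwise by a multiple of M_{α+β} f. -/
theorem commutatorBounded [IsTopologicalGroup G] [SecondCountableTopology G] [BorelSpace G]
    [SFinite μ] (h : IsAhlforsNorm μ ρ Q K c) {α β : ℝ} (hα : 0 ≤ α) (hβ : 0 < β) {b : G → ℝ}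
    (hb : MemLip ρ β b) (hb0 : ∀ x, 0 ≤ b x) {p q : ℝ} (hp : 1 < p) (hpQ : p < Q / (α + β))
    (hq : 1 / q = 1 / p - (α + β) / Q) : CommutatorBounded μ ρ Q α b p q := by
  have hbc := h.continuous_of_memLip hβ hb
  obtain ⟨L, hL, hb⟩ := hb
  have hQ := h.dim_pos
  have hK := h.K_pos
  have hc := h.const_pos
  have hp0 : 0 < p := by linarith
  have hαβ : 0 < α + β := by linarith
  have hpαβ : 0 < 1 / p - (α + β) / Q := by
    rw [sub_pos, div_lt_div_iff₀ hQ hp0, one_mul]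
    rwa [lt_div_iff₀ hαβ, mul_comm] at hpQ
  have hpα : 0 < 1 / p - α / Q := by
    have : α / Q ≤ (α + β) / Q := by gcongr; linarith
    linarith
  have hq0 : 0 < q := by rw [← one_div_pos, hq]; exact hpαβ
  have hpq : p ≤ q := by
    rw [← one_div_le_one_div hq0 hp0, hq]
    have : 0 < (α + β) / Q := by positivity
    linarith
  obtain ⟨C, hC⟩ := h.exists_lintegral_fracMaximal_rpow_le hp hpq hq
  set Λ := L * K ^ β * c ^ (-(β / Q)) with hΛ
  have hΛ0 : 0 < Λ := by positivity
  refine ⟨Λ.toNNReal * C, fun f hf => ?_⟩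
  -- Finiteness of M_α f comes from its own mapping property, with target exponent determined by α
  -- alone. Finiteness of M_α (bf) then follows from the pointwise comparison, as bf need not lie in
  -- any L^p.
  have hfin : ∀ᵐ x ∂μ, fracMaximal μ ρ Q α f x < ⊤ ∧
      fracMaximal μ ρ Q α (fun y => b y * f y) x < ⊤ := by
    filter_upwards [h.ae_fracMaximal_lt_top hp hα hpα hf,
      h.ae_fracMaximal_lt_top hp hαβ.le hpαβ hf] with x h1 h2
    exact ⟨h1, (h.fracMaximal_mul_le hβ hL hb α f x).trans_lt
      (ENNReal.add_lt_top.2 ⟨ENNReal.mul_lt_top enorm_lt_top h1,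
        ENNReal.mul_lt_top ENNReal.ofReal_lt_top h2⟩)⟩
  have hmeas : Measurable (maximalCommutator μ ρ Q α b f) :=
    (hbc.measurable.mul (h.measurable_fracMaximal α f).ennreal_toReal).sub
      (h.measurable_fracMaximal α _).ennreal_toReal
  have hpt : ∀ᵐ x ∂μ, ‖maximalCommutator μ ρ Q α b f x‖ₑ ≤
      ENNReal.ofReal Λ * fracMaximal μ ρ Q (α + β) f x := by
    filter_upwards [hfin] with x hx
    have e : b x * (fracMaximal μ ρ Q α f x).toReal =
        (‖b x‖ₑ * fracMaximal μ ρ Q α f x).toReal := by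
      rw [ENNReal.toReal_mul, toReal_enorm, Real.norm_of_nonneg (hb0 x)]
    rw [maximalCommutator, e]
    exact ENNReal.enorm_toReal_sub_toReal_le (ENNReal.mul_lt_top enorm_lt_top hx.1).ne hx.2.ne
      (h.mul_fracMaximal_le hβ hL hb α hf.1 x) (h.fracMaximal_mul_le hβ hL hb α f x)
  have hnorm : eLpNorm (maximalCommutator μ ρ Q α b f) (ENNReal.ofReal q) μ ≤
      ((Λ.toNNReal * C : ℝ≥0) : ℝ≥0∞) * eLpNorm f (ENNReal.ofReal p) μ := by
    rw [eLpNorm_ofReal_eq _ hq0]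
    calc (∫⁻ x, ‖maximalCommutator μ ρ Q α b f x‖ₑ ^ q ∂μ) ^ (1 / q)
        ≤ (∫⁻ x, ENNReal.ofReal Λ ^ q * fracMaximal μ ρ Q (α + β) f x ^ q ∂μ) ^ (1 / q) := by
          refine ENNReal.rpow_le_rpow (lintegral_mono_ae ?_) (by positivity)
          filter_upwards [hpt] with x hx
          rw [← ENNReal.mul_rpow_of_nonneg _ _ hq0.le]
          exact ENNReal.rpow_le_rpow hx hq0.le
      _ = ENNReal.ofReal Λ * (∫⁻ x, fracMaximal μ ρ Q (α + β) f x ^ q ∂μ) ^ (1 / q) := by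
          rw [lintegral_const_mul' _ _ (ENNReal.rpow_ne_top_of_nonneg hq0.le ENNReal.ofReal_ne_top),
            ENNReal.mul_rpow_of_nonneg _ _ (by positivity), ← ENNReal.rpow_mul,
            mul_one_div_cancel hq0.ne', ENNReal.rpow_one]
      _ ≤ _ := by
          rw [ENNReal.coe_mul, mul_assoc]
          exact mul_le_mul_right (hC f hf.1) _
  exact ⟨hfin, ⟨hmeas.aestronglyMeasurable,
    hnorm.trans_lt (ENNReal.mul_lt_top ENNReal.coe_lt_top hf.2)⟩, hnorm⟩

/-- For a subball B' of B containing x, the mean of |b| is at most |b(x)| plus the Lipschitz error,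
and |B'|^(α/Q) ≤ |B|^(α/Q) since α ≥ 0. This is the upper bound for the local maximal function; the
lower bound uses B itself as competitor. -/
lemma enorm_sub_localFracMaximal_le [IsTopologicalGroup G] [BorelSpace G]
    (h : IsAhlforsNorm μ ρ Q K c) {L α β : ℝ} (hα : 0 ≤ α) (hβ : 0 < β) (hL : 0 < L)
    {b : G → ℝ} (hb : ∀ x y, |b x - b y| ≤ L * ρ (y⁻¹ * x) ^ β) (hb0 : ∀ x, 0 ≤ b x)
    {x z : G} {r : ℝ} (hr : 0 < r) (hx : x ∈ gBall ρ z r) :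
    localFracMaximal μ ρ Q α (gBall ρ z r) b x < ⊤ ∧
    ‖b x - (μ (gBall ρ z r)).toReal ^ (-(α / Q)) *
      (localFracMaximal μ ρ Q α (gBall ρ z r) b x).toReal‖ₑ ≤
        ENNReal.ofReal (L * (K * r) ^ β) := by
  set δ := ENNReal.ofReal (L * (K * r) ^ β) with hδ
  have hV0 := h.measure_ne_zero z hr
  have hVt := h.measure_ne_top z hr
  have hαQ : 0 ≤ α / Q := div_nonneg hα h.dim_pos.le
  set M := localFracMaximal μ ρ Q α (gBall ρ z r) b x with hM
  have h1 : M ≤ (‖b x‖ₑ + δ) * μ (gBall ρ z r) ^ (α / Q) := by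
    refine localFracMaximal_le fun w t ht hxw hsub => ?_
    have : ∫⁻ y in gBall ρ w t, ‖b y‖ₑ ∂μ ≤ (‖b x‖ₑ + δ) * μ (gBall ρ w t) := by
      rw [← setLIntegral_const]
      exact setLIntegral_mono' (h.measurableSet_gBall w t) fun y hy =>
        h.enorm_le_add_of_mem hβ hL hb (hsub hy) hx
    refine (ENNReal.div_le_div_right this _).trans ?_
    rw [mul_div_assoc, h.measure_div_rpow α w ht]
    gcongr
  have h2 : ‖b x‖ₑ * μ (gBall ρ z r) ^ (α / Q) ≤ M + δ * μ (gBall ρ z r) ^ (α / Q) := by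
    have : ‖b x‖ₑ * μ (gBall ρ z r) ≤ ∫⁻ y in gBall ρ z r, ‖b y‖ₑ ∂μ + δ * μ (gBall ρ z r) := by
      rw [← setLIntegral_const, ← setLIntegral_const, ← lintegral_add_right _ measurable_const]
      exact setLIntegral_mono' (h.measurableSet_gBall z r) fun y hy =>
        h.enorm_le_add_of_mem hβ hL hb hx hy
    rw [← h.measure_div_rpow α z hr, ← mul_div_assoc, ← mul_div_assoc]
    refine (ENNReal.div_le_div_right this _).trans ?_
    rw [ENNReal.add_div]
    gcongr
    exact le_localFracMaximal α b hr hx subset_rfl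
  have hMt : M < ⊤ := h1.trans_lt (ENNReal.mul_lt_top (by simp [hδ])
    (ENNReal.rpow_lt_top_of_nonneg hαQ hVt))
  refine ⟨hMt, ?_⟩
  set V := μ (gBall ρ z r)
  have hcancel : V ^ (-(α / Q)) * V ^ (α / Q) = 1 := by
    rw [← ENNReal.rpow_add _ _ hV0 hVt]; simp
  have e : b x = (‖b x‖ₑ).toReal := by rw [toReal_enorm, Real.norm_of_nonneg (hb0 x)]
  have hWt : V ^ (-(α / Q)) ≠ ⊤ := by simp [ENNReal.rpow_eq_top_iff, hV0, hVt]
  rw [ENNReal.toReal_rpow, ← ENNReal.toReal_mul]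
  nth_rewrite 1 [e]
  refine ENNReal.enorm_toReal_sub_toReal_le enorm_ne_top (ENNReal.mul_lt_top hWt.lt_top hMt).ne ?_ ?_
  · calc ‖b x‖ₑ = V ^ (-(α / Q)) * (‖b x‖ₑ * V ^ (α / Q)) := by
          rw [mul_left_comm, hcancel, mul_one]
      _ ≤ V ^ (-(α / Q)) * (M + δ * V ^ (α / Q)) := by gcongr
      _ = _ := by rw [mul_add, mul_left_comm _ δ, hcancel, mul_one]
  · calc V ^ (-(α / Q)) * M ≤ V ^ (-(α / Q)) * ((‖b x‖ₑ + δ) * V ^ (α / Q)) := by gcongr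
      _ = _ := by rw [mul_left_comm, hcancel, mul_one]

theorem oscillationCondition [IsTopologicalGroup G] [BorelSpace G]
    (h : IsAhlforsNorm μ ρ Q K c) {α β s : ℝ} (hα : 0 ≤ α) (hβ : 0 < β) (hs : 0 < s)
    {b : G → ℝ} (hb : MemLip ρ β b) (hb0 : ∀ x, 0 ≤ b x) : OscillationCondition μ ρ Q α β s b := by
  obtain ⟨L, hL, hb⟩ := hb
  refine ⟨fun z r hr => (ae_restrict_iff' (h.measurableSet_gBall z r)).2 (ae_of_all _ fun x hx =>
    (h.enorm_sub_localFracMaximal_le hα hβ hL hb hb0 hr hx).1), ?_⟩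
  refine (iSup₂_le fun z r => iSup_le fun hr => ?_ :
    _ ≤ ENNReal.ofReal (L * K ^ β * c ^ (-(β / Q)))).trans_lt ENNReal.ofReal_lt_top
  have hV0 := h.measure_ne_zero z hr
  have hVt := h.measure_ne_top z hr
  calc maximalOscillation μ ρ Q α β s b (gBall ρ z r)
      ≤ μ (gBall ρ z r) ^ (-(β / Q)) * ((μ (gBall ρ z r))⁻¹ *
          ∫⁻ x in gBall ρ z r, ENNReal.ofReal (L * (K * r) ^ β) ^ s ∂μ) ^ (1 / s) := by
        unfold maximalOscillation
        gcongr _ * (_ * ?_) ^ _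
        exact setLIntegral_mono' (h.measurableSet_gBall z r) fun x hx => ENNReal.rpow_le_rpow
          (h.enorm_sub_localFracMaximal_le hα hβ hL hb hb0 hr hx).2 hs.le
    _ = μ (gBall ρ z r) ^ (-(β / Q)) * ENNReal.ofReal (L * (K * r) ^ β) := by
        rw [setLIntegral_const, mul_left_comm, ENNReal.inv_mul_cancel hV0 hVt, mul_one,
          ← ENNReal.rpow_mul, mul_one_div_cancel hs.ne', ENNReal.rpow_one]
    _ ≤ _ := by
        rw [h.ofReal_lip_eq hL z hr, mul_left_comm, ← ENNReal.rpow_add _ _ hV0 hVt]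
        simp

end IsAhlforsNorm

/-! ### Mean oscillation and Campanato's theorem. -/

lemma tendsto_const_mul_inv_succ_rpow (C : ℝ) {β : ℝ} (hβ : 0 < β) :
    Tendsto (fun k : ℕ => C * (1 / ((k : ℝ) + 1)) ^ β) atTop (𝓝 0) := by
  have := ((tendsto_one_div_add_atTop_nhds_zero_nat (𝕜 := ℝ)).rpow_const
    (Or.inr hβ.le : (0 : ℝ) ≠ 0 ∨ 0 ≤ β)).const_mul C
  rwa [Real.zero_rpow hβ.ne', mul_zero] at this

/-- If `|b|_B ≤ N` on `B`, then `|b|_B - b_B` and the mean oscillation of `b` on `B` are controlled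
by the mean of `|b - N|`. -/
lemma integral_abs_sub_average_le {X : Type*} [MeasurableSpace X] {μ : Measure X} {B : Set X}
    (hB0 : μ B ≠ 0) (hBt : μ B ≠ ⊤) {b N : X → ℝ} (hb : IntegrableOn b B μ) {A : ℝ} (hA : 0 ≤ A)
    (hN : ∀ᵐ x ∂μ.restrict B, ⨍ y in B, |b y| ∂μ ≤ N x)
    (hbN : ∫⁻ x in B, ‖b x - N x‖ₑ ∂μ ≤ ENNReal.ofReal A * μ B) :
    ∫ x in B, |b x - ⨍ y in B, b y ∂μ| ∂μ ≤ 2 * A * μ.real B ∧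
      |⨍ y in B, b y ∂μ| - ⨍ y in B, b y ∂μ ≤ A := by
  have hV : 0 < μ.real B := ENNReal.toReal_pos hB0 hBt
  have hconst : ∀ a : ℝ, IntegrableOn (fun _ => a) B μ := fun a => integrableOn_const hBt
  set m := ⨍ y in B, b y ∂μ with hm
  set m' := ⨍ y in B, |b y| ∂μ with hm'
  have hmV : ∫ x in B, b x ∂μ = m * μ.real B := by
    rw [hm, setAverage_eq, smul_eq_mul]; field_simp
  have hmm' : |m| ≤ m' := by
    rw [hm, hm', setAverage_eq, setAverage_eq, smul_eq_mul, smul_eq_mul, abs_mul,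
      abs_of_pos (inv_pos.2 hV)]
    gcongr
    exact abs_integral_le_integral_abs
  have hint : ∀ a : ℝ, IntegrableOn (fun x => max (a - b x) 0) B μ := fun a =>
    ((hconst a).sub hb).pos_part
  -- Where b < m', the inequality m' ≤ N gives 0 < m' - b ≤ N - b.
  have hJ : ∫ x in B, max (m' - b x) 0 ∂μ ≤ A * μ.real B := by
    refine (ENNReal.ofReal_le_ofReal_iff (by positivity)).1 ?_
    rw [ofReal_integral_eq_lintegral_ofReal (hint m') (ae_of_all _ fun x => le_max_right _ _),
      ENNReal.ofReal_mul hA, ofReal_measureReal hBt]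
    refine (lintegral_mono_ae ?_).trans hbN
    filter_upwards [hN] with x hx
    rw [Real.enorm_eq_ofReal_abs]
    refine ENNReal.ofReal_le_ofReal (max_le ?_ (abs_nonneg _))
    rw [abs_sub_comm]
    exact (sub_le_sub_right hx _).trans (le_abs_self _)
  constructor
  · have e : ∀ x, |b x - m| = 2 * max (m - b x) 0 + (b x - m) := by
      intro x
      rcases le_total (b x) m with hx | hx
      · rw [abs_of_nonpos (by linarith), max_eq_left (by linarith)]; ring
      · rw [abs_of_nonneg (by linarith), max_eq_right (by linarith)]; ring
    simp_rw [e]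
    have hsub : Integrable (fun x => b x - m) (μ.restrict B) := hb.sub (hconst m)
    rw [integral_add ((hint m).const_mul 2) hsub, integral_const_mul,
      integral_sub hb (hconst m), hmV, setIntegral_const, smul_eq_mul]
    have : ∫ x in B, max (m - b x) 0 ∂μ ≤ ∫ x in B, max (m' - b x) 0 ∂μ := by
      refine integral_mono (hint m) (hint m') fun x => max_le_max_right _ ?_
      have := (le_abs_self m).trans hmm'
      linarith
    linarith [mul_comm m (μ.real B)]
  · have h1 : ∫ x in B, (m' - b x) ∂μ ≤ ∫ x in B, max (m' - b x) 0 ∂μ :=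
      integral_mono ((hconst m').sub hb) (hint m') fun x => le_max_left _ _
    rw [integral_sub (hconst m') hb, hmV, setIntegral_const, smul_eq_mul] at h1
    have h2 : (m' - m) * μ.real B ≤ A * μ.real B := by linarith [mul_comm m' (μ.real B)]
    have := le_of_mul_le_mul_right h2 hV
    linarith

namespace IsAhlforsNorm

variable {G : Type*} [TopologicalSpace G] [Group G]
  [MeasurableSpace G] {μ : Measure G} {ρ : G → ℝ} {Q K c : ℝ}

lemma integrableOn_gBall (h : IsAhlforsNorm μ ρ Q K c) {b : G → ℝ} (hb : LocallyIntegrable b μ)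
    (z : G) (r : ℝ) : IntegrableOn b (gBall ρ z r) μ := by
  obtain ⟨S, hS, hsub⟩ := h.subset_compact z r
  exact (hb.integrableOn_isCompact hS).mono_set hsub

lemma measureReal_gBall (h : IsAhlforsNorm μ ρ Q K c) (z : G) {r : ℝ} (hr : 0 < r) :
    μ.real (gBall ρ z r) = c * r ^ Q := by
  have := h.const_pos
  rw [measureReal_def, h.measure_ball z r hr, ENNReal.toReal_ofReal (by positivity)]

/-- The integral of |b - m| over the small ball is at most that over the large one. Normalizing by
the small measure costs the ratio of measures, (r/t)^Q. The centres may differ, which is needed to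
compare values at two points. -/
lemma abs_average_sub_average_le (h : IsAhlforsNorm μ ρ Q K c) {b : G → ℝ}
    (hb : LocallyIntegrable b μ) {A β : ℝ}
    (hosc : ∀ z r, 0 < r → ∫ x in gBall ρ z r, |b x - ⨍ y in gBall ρ z r, b y ∂μ| ∂μ ≤
      A * r ^ β * μ.real (gBall ρ z r)) {w z : G} {t r : ℝ} (ht : 0 < t) (hr : 0 < r)
    (hsub : gBall ρ w t ⊆ gBall ρ z r) :
    |⨍ y in gBall ρ w t, b y ∂μ - ⨍ y in gBall ρ z r, b y ∂μ| ≤ (r / t) ^ Q * A * r ^ β := by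
  have hc := h.const_pos
  set m := ⨍ y in gBall ρ z r, b y ∂μ with hm
  have hV := h.measureReal_gBall w ht
  have hV0 : 0 < μ.real (gBall ρ w t) := by rw [hV]; positivity
  have hi : ∀ z r, 0 < r → IntegrableOn (fun y => b y - m) (gBall ρ z r) μ := fun z r hr =>
    (h.integrableOn_gBall hb z r).sub (integrableOn_const (h.measure_ne_top z hr))
  have e : ⨍ y in gBall ρ w t, b y ∂μ - m =
      (μ.real (gBall ρ w t))⁻¹ * ∫ y in gBall ρ w t, (b y - m) ∂μ := by
    rw [integral_sub (h.integrableOn_gBall hb w t) (integrableOn_const (h.measure_ne_top w ht)),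
      setAverage_eq, setIntegral_const, smul_eq_mul, smul_eq_mul]
    field_simp
  rw [e, abs_mul, abs_of_pos (inv_pos.2 hV0)]
  calc (μ.real (gBall ρ w t))⁻¹ * |∫ y in gBall ρ w t, (b y - m) ∂μ|
      ≤ (μ.real (gBall ρ w t))⁻¹ * (A * r ^ β * μ.real (gBall ρ z r)) := by
        gcongr
        refine abs_integral_le_integral_abs.trans (le_trans ?_ (hosc z r hr))
        exact setIntegral_mono_set (hi z r hr).abs (ae_of_all _ fun y => abs_nonneg _)
          hsub.eventuallyLE
    _ = _ := by
        rw [hV, h.measureReal_gBall z hr, Real.div_rpow hr.le ht.le]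
        have : t ^ Q ≠ 0 := by positivity
        field_simp

/-- Repeated halving of the radius produces a geometric series of ratio 2^(-β), so the bound does
not depend on t. -/
lemma abs_average_sub_average_le_of_le (h : IsAhlforsNorm μ ρ Q K c) {b : G → ℝ}
    (hb : LocallyIntegrable b μ) {A β : ℝ} (hA : 0 < A) (hβ : 0 < β)
    (hosc : ∀ z r, 0 < r → ∫ x in gBall ρ z r, |b x - ⨍ y in gBall ρ z r, b y ∂μ| ∂μ ≤
      A * r ^ β * μ.real (gBall ρ z r)) (z : G) {t r : ℝ} (ht : 0 < t) (htr : t ≤ r) :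
    |⨍ y in gBall ρ z t, b y ∂μ - ⨍ y in gBall ρ z r, b y ∂μ| ≤
      2 ^ Q * A / (1 - 2⁻¹ ^ β) * r ^ β := by
  have h2 : (2⁻¹ : ℝ) ^ β < 1 := Real.rpow_lt_one (by norm_num) (by norm_num) hβ
  set C := 2 ^ Q * A / (1 - 2⁻¹ ^ β) with hC
  -- C is the fixed point that closes the induction: one halving step plus the bound at radius r/2.
  have hC1 : 2 ^ Q * A + C * 2⁻¹ ^ β = C := by
    have : C * (1 - 2⁻¹ ^ β) = 2 ^ Q * A := div_mul_cancel₀ _ (by linarith)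
    linarith
  have hC2 : 2 ^ Q * A ≤ C := by
    have : 0 ≤ C * 2⁻¹ ^ β := by
      have : 0 < 1 - (2⁻¹ : ℝ) ^ β := by linarith
      positivity
    linarith
  have key : ∀ k : ℕ, ∀ r t : ℝ, 0 < r → r / 2 ^ k ≤ t → t ≤ r →
      |⨍ y in gBall ρ z t, b y ∂μ - ⨍ y in gBall ρ z r, b y ∂μ| ≤ C * r ^ β := by
    intro k
    induction k with
    | zero =>
      intro r t hr h1 h2
      obtain rfl : t = r := le_antisymm h2 (by simpa using h1)
      rw [sub_self, abs_zero]
      have : 0 ≤ C := le_trans (by positivity) hC2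
      positivity
    | succ k ih =>
      intro r t hr h1 h2
      have ht : 0 < t := lt_of_lt_of_le (by positivity) h1
      have direct : ∀ s, r / 2 ≤ s → s ≤ r →
          |⨍ y in gBall ρ z s, b y ∂μ - ⨍ y in gBall ρ z r, b y ∂μ| ≤ 2 ^ Q * A * r ^ β := by
        intro s hs1 hs2
        have hs : 0 < s := by linarith
        refine (h.abs_average_sub_average_le hb hosc hs hr (gBall_mono hs2)).trans ?_
        have := h.dim_pos.le
        gcongr
        rw [div_le_iff₀ hs]; linarith
      rcases le_total (r / 2) t with h3 | h3
      · exact (direct t h3 h2).trans (by gcongr)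
      · have e1 := ih (r / 2) t (by linarith) (by rwa [div_div, ← pow_succ']) h3
        have e2 := direct (r / 2) le_rfl (by linarith)
        have e3 : (r / 2) ^ β = 2⁻¹ ^ β * r ^ β := by
          rw [div_eq_inv_mul, Real.mul_rpow (by norm_num) hr.le]
        calc _ ≤ C * (r / 2) ^ β + 2 ^ Q * A * r ^ β :=
              (abs_sub_le _ (⨍ y in gBall ρ z (r / 2), b y ∂μ) _).trans (add_le_add e1 e2)
          _ = (2 ^ Q * A + C * 2⁻¹ ^ β) * r ^ β := by rw [e3]; ring
          _ = _ := by rw [hC1]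
  have hr : 0 < r := ht.trans_le htr
  obtain ⟨k, hk⟩ := pow_unbounded_of_one_lt (r / t) one_lt_two
  refine key k r t hr ?_ htr
  rw [div_le_iff₀ (by positivity)]
  rw [div_lt_iff₀ ht] at hk
  linarith

/-- Tonelli together with the symmetry y ∈ B(x,r) if and only if x ∈ B(y,r). -/
lemma lintegral_lintegral_gBall [IsTopologicalGroup G] [SecondCountableTopology G] [BorelSpace G]
    [SFinite μ] (h : IsAhlforsNorm μ ρ Q K c) {g : G → ℝ≥0∞} (hg : AEMeasurable g μ) {S : Set G}
    (hS : MeasurableSet S) (r : ℝ) :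
    ∫⁻ x in S, (∫⁻ y in gBall ρ x r, g y ∂μ) ∂μ = ∫⁻ y, μ (S ∩ gBall ρ y r) * g y ∂μ := by
  have hO : MeasurableSet {z : G × G | z.1 ∈ S ∧ ρ (z.2⁻¹ * z.1) < r} :=
    (measurable_fst hS).inter
      (isOpen_lt (h.continuous.comp (by fun_prop)) continuous_const).measurableSet
  calc ∫⁻ x in S, (∫⁻ y in gBall ρ x r, g y ∂μ) ∂μ
      = ∫⁻ x, (∫⁻ y, {z : G × G | z.1 ∈ S ∧ ρ (z.2⁻¹ * z.1) < r}.indicator 1 (x, y) * g y ∂μ)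
          ∂μ := by
        rw [← lintegral_indicator hS]
        refine lintegral_congr fun x => ?_
        by_cases hx : x ∈ S
        · rw [indicator_of_mem hx, ← lintegral_indicator (h.measurableSet_gBall x r)]
          refine lintegral_congr fun y => ?_
          by_cases hy : y ∈ gBall ρ x r
          · have : ρ (y⁻¹ * x) < r := hy
            simp [hx, hy, this]
          · have : ¬ ρ (y⁻¹ * x) < r := hy
            simp [hx, hy, this]
        · simp [hx]
    _ = ∫⁻ y, (∫⁻ x, {z : G × G | z.1 ∈ S ∧ ρ (z.2⁻¹ * z.1) < r}.indicator 1 (x, y) * g y ∂μ)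
          ∂μ := by
        refine lintegral_lintegral_swap (AEMeasurable.mul
          (measurable_one.indicator hO).aemeasurable hg.comp_snd)
    _ = _ := by
        refine lintegral_congr fun y => ?_
        have hm : Measurable fun x : G =>
            {z : G × G | z.1 ∈ S ∧ ρ (z.2⁻¹ * z.1) < r}.indicator (1 : G × G → ℝ≥0∞) (x, y) :=
          (measurable_one.indicator hO).comp measurable_prodMk_right
        rw [lintegral_mul_const _ hm]
        congr 1
        rw [← lintegral_indicator_one (hS.inter (h.measurableSet_gBall y r))]
        refine lintegral_congr fun x => ?_
        have : (x, y) ∈ {z : G × G | z.1 ∈ S ∧ ρ (z.2⁻¹ * z.1) < r} ↔ x ∈ S ∩ gBall ρ y r := by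
          rw [mem_inter_iff, ← h.mem_comm]; rfl
        by_cases hx : x ∈ S ∩ gBall ρ y r
        · rw [indicator_of_mem hx, indicator_of_mem (this.2 hx)]; rfl
        · rw [indicator_of_notMem hx, indicator_of_notMem (mt this.1 hx)]

/-- A function whose integral over balls of radius `r` is `o(r ^ Q)`, uniformly, vanishes almost
everywhere. -/
lemma ae_eq_zero_of_lintegral_gBall_le [IsTopologicalGroup G] [SecondCountableTopology G]
    [BorelSpace G] [SFinite μ] (h : IsAhlforsNorm μ ρ Q K c) {g : G → ℝ≥0∞}
    (hg : AEMeasurable g μ) {D β : ℝ} (hβ : 0 < β)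
    (hgB : ∀ x r, 0 < r →
      ∫⁻ y in gBall ρ x r, g y ∂μ ≤ ENNReal.ofReal (D * r ^ β) * μ (gBall ρ x r)) :
    g =ᵐ[μ] 0 := by
  have hK := h.K_pos
  have hzero : ∀ R : ℝ, 0 < R → ∫⁻ y in gBall ρ 1 R, g y ∂μ = 0 := by
    intro R hR
    -- S contains B(y,r) whenever y ∈ B(1,R) and r ≤ R. Tonelli then bounds |B(1,r)| ∫ g over B(1,R)
    -- by the integral over x ∈ S of the small-ball integrals. Cancelling |B(1,r)| and letting r
    -- tend to 0 replaces Lebesgue differentiation.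
    set S := gBall ρ 1 (K * R) with hS
    have hbound : ∀ r, 0 < r → r ≤ R →
        ∫⁻ y in gBall ρ 1 R, g y ∂μ ≤ ENNReal.ofReal (D * r ^ β) * μ S := by
      intro r hr hrR
      have hV0 := h.measure_ne_zero 1 hr
      have hVt := h.measure_ne_top 1 hr
      have hV : ∀ x, μ (gBall ρ x r) = μ (gBall ρ 1 r) := fun x => by
        rw [h.measure_ball x r hr, h.measure_ball 1 r hr]
      refine (ENNReal.mul_le_mul_iff_right hV0 hVt).1 ?_
      calc μ (gBall ρ 1 r) * ∫⁻ y in gBall ρ 1 R, g y ∂μ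
          = ∫⁻ y in gBall ρ 1 R, μ (gBall ρ 1 r) * g y ∂μ := (lintegral_const_mul' _ _ hVt).symm
        _ ≤ ∫⁻ y in gBall ρ 1 R, μ (S ∩ gBall ρ y r) * g y ∂μ := by
            refine setLIntegral_mono' (h.measurableSet_gBall 1 R) fun y hy => ?_
            have : gBall ρ y r ⊆ S := fun z hz =>
              h.dist_lt (mem_gBall.1 hz) (mem_gBall.1 hy) (by gcongr) le_rfl
            rw [inter_eq_self_of_subset_right this, hV y]
        _ ≤ ∫⁻ y, μ (S ∩ gBall ρ y r) * g y ∂μ := setLIntegral_le_lintegral _ _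
        _ = ∫⁻ x in S, (∫⁻ y in gBall ρ x r, g y ∂μ) ∂μ :=
            (h.lintegral_lintegral_gBall hg (h.measurableSet_gBall _ _) r).symm
        _ ≤ ∫⁻ x in S, ENNReal.ofReal (D * r ^ β) * μ (gBall ρ 1 r) ∂μ :=
            lintegral_mono fun x => (hgB x r hr).trans_eq (by rw [hV x])
        _ = _ := by rw [setLIntegral_const]; ring
    have hlim : Tendsto (fun k : ℕ => ENNReal.ofReal (D * (1 / ((k : ℝ) + 1)) ^ β) * μ S) atTop
        (𝓝 0) := by
      have h1 := ENNReal.tendsto_ofReal (tendsto_const_mul_inv_succ_rpow D hβ)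
      have h2 := ENNReal.Tendsto.mul_const h1
        (Or.inr (h.measure_ne_top 1 (mul_pos hK hR)))
      simpa using h2
    refine le_antisymm (ge_of_tendsto hlim ?_) zero_le
    filter_upwards [(tendsto_one_div_add_atTop_nhds_zero_nat (𝕜 := ℝ)).eventually_le_const hR]
      with k hk
    exact hbound _ (by positivity) hk
  have hU : ⋃ k : ℕ, gBall ρ (1 : G) ((k : ℝ) + 1) = univ := by
    refine eq_univ_of_forall fun x => mem_iUnion.2 ?_
    obtain ⟨k, hk⟩ := exists_nat_gt (ρ (x⁻¹ * 1))
    exact ⟨k, mem_gBall.2 (by linarith)⟩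
  rw [← Measure.restrict_univ (μ := μ), ← hU]
  refine (ae_restrict_iUnion_iff _ _).2 fun k => ?_
  exact (lintegral_eq_zero_iff' hg.restrict).1 (hzero _ (by positivity))

/-- Campanato's characterization of Lipschitz functions. -/
theorem exists_ae_eq_memLip [IsTopologicalGroup G] [SecondCountableTopology G]
    [BorelSpace G] [SFinite μ] (h : IsAhlforsNorm μ ρ Q K c) {b : G → ℝ}
    (hb : LocallyIntegrable b μ) {A β : ℝ} (hA : 0 < A) (hβ : 0 < β)
    (hosc : ∀ z r, 0 < r → ∫ x in gBall ρ z r, |b x - ⨍ y in gBall ρ z r, b y ∂μ| ∂μ ≤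
      A * r ^ β * μ.real (gBall ρ z r)) :
    ∃ b' : G → ℝ, b =ᵐ[μ] b' ∧ MemLip ρ β b' ∧
      ∃ C : ℝ, ∀ x r, 0 < r → |b' x - ⨍ y in gBall ρ x r, b y ∂μ| ≤ C * r ^ β := by
  have hK := h.K_pos
  have hQ := h.dim_pos
  have h2 : 0 < 1 - (2⁻¹ : ℝ) ^ β :=
    sub_pos.2 (Real.rpow_lt_one (by norm_num) (by norm_num) hβ)
  set C := 2 ^ Q * A / (1 - 2⁻¹ ^ β) with hC
  have hC0 : 0 < C := by positivity
  have hav : ∀ (z : G) (t r : ℝ), 0 < t → t ≤ r →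
      |⨍ y in gBall ρ z t, b y ∂μ - ⨍ y in gBall ρ z r, b y ∂μ| ≤ C * r ^ β :=
    fun z t r ht htr => h.abs_average_sub_average_le_of_le hb hA hβ hosc z ht htr
  have hcauchy : ∀ x, CauchySeq fun k : ℕ => ⨍ y in gBall ρ x (1 / ((k : ℝ) + 1)), b y ∂μ := by
    intro x
    refine cauchySeq_of_le_tendsto_0 _ (fun n m N hn hm => ?_)
      (tendsto_const_mul_inv_succ_rpow (2 * C) hβ)
    have h1 := hav x (1 / ((n : ℝ) + 1)) (1 / ((N : ℝ) + 1)) (by positivity) (by gcongr)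
    have h2 := hav x (1 / ((m : ℝ) + 1)) (1 / ((N : ℝ) + 1)) (by positivity) (by gcongr)
    rw [abs_sub_comm] at h2
    rw [Real.dist_eq]
    refine (abs_sub_le _ _ _).trans ((add_le_add h1 h2).trans_eq (by ring))
  choose b' hb' using fun x => cauchySeq_tendsto_of_complete (hcauchy x)
  have hclose : ∀ x r, 0 < r → |b' x - ⨍ y in gBall ρ x r, b y ∂μ| ≤ C * r ^ β := by
    intro x r hr
    refine le_of_tendsto (((hb' x).sub_const _).abs) ?_
    filter_upwards [(tendsto_one_div_add_atTop_nhds_zero_nat (𝕜 := ℝ)).eventually_le_const hr]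
      with k hk
    exact hav x _ r (by positivity) hk
  -- With d = ρ(y⁻¹x), the terms compare in turn b'(x) with the mean on B(x, 2Kd), that mean with
  -- the one on B(y, d), and the latter with b'(y). The radius 2Kd rather than Kd leaves room for
  -- the strict inequality defining balls.
  set L := C * (2 * K) ^ β + (2 * K) ^ Q * A * (2 * K) ^ β + C with hL
  have hL0 : 0 < L := by positivity
  have hlip : ∀ x y, |b' x - b' y| ≤ L * ρ (y⁻¹ * x) ^ β := by
    intro x y
    rcases (h.nonneg (y⁻¹ * x)).eq_or_lt with hd | hd
    · have hxy : y⁻¹ * x = 1 := (h.eq_zero_iff _).1 hd.symm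
      rw [inv_mul_eq_one] at hxy
      rw [← hd, hxy, sub_self, abs_zero, Real.zero_rpow hβ.ne', mul_zero]
    · set d := ρ (y⁻¹ * x) with hd'
      have hsub : gBall ρ y d ⊆ gBall ρ x (2 * K * d) := fun z hz =>
        h.dist_lt (s := 2 * d) (mem_gBall.1 hz) (by linarith) (by nlinarith) (by linarith)
      have e1 := hclose x (2 * K * d) (by positivity)
      have e2 := h.abs_average_sub_average_le hb hosc hd (by positivity) hsub
      have e3 := hclose y d hd
      rw [mul_div_assoc, div_self hd.ne', mul_one] at e2
      rw [Real.mul_rpow (by positivity) hd.le] at e1 e2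
      rw [abs_le] at *
      constructor <;> nlinarith
  refine ⟨b', ?_, ⟨L, hL0, hlip⟩, C, hclose⟩
  have hb'c : Continuous b' := h.continuous_of_memLip hβ ⟨L, hL0, hlip⟩
  have hbm : AEStronglyMeasurable (fun x => b x - b' x) μ :=
    hb.aestronglyMeasurable.sub hb'c.aestronglyMeasurable
  have hzero := h.ae_eq_zero_of_lintegral_gBall_le hbm.enorm (D := A + (C + L)) hβ (by
    intro x r hr
    have hVt := h.measure_ne_top x hr
    set m := ⨍ y in gBall ρ x r, b y ∂μ with hm
    have hi : IntegrableOn (fun y => b y - m) (gBall ρ x r) μ :=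
      (h.integrableOn_gBall hb x r).sub (integrableOn_const hVt)
    calc ∫⁻ y in gBall ρ x r, ‖b y - b' y‖ₑ ∂μ
        ≤ ∫⁻ y in gBall ρ x r, (‖b y - m‖ₑ + ENNReal.ofReal ((C + L) * r ^ β)) ∂μ := by
          refine setLIntegral_mono' (h.measurableSet_gBall x r) fun y hy => ?_
          rw [Real.enorm_eq_ofReal_abs, Real.enorm_eq_ofReal_abs,
            ← ENNReal.ofReal_add (abs_nonneg _) (by positivity)]
          refine ENNReal.ofReal_le_ofReal ?_
          have e1 := hclose x r hr
          have e2 : |b' x - b' y| ≤ L * r ^ β := by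
            refine (hlip x y).trans ?_
            have := h.nonneg (y⁻¹ * x)
            have := (mem_gBall.1 hy).le
            gcongr
          have e3 : b y - b' y = (b y - m) + (m - b' x) + (b' x - b' y) := by ring
          rw [e3]
          refine (abs_add_le _ _).trans ?_
          have := abs_add_le (b y - m) (m - b' x)
          rw [abs_sub_comm m] at this
          linarith
      _ = ∫⁻ y in gBall ρ x r, ‖b y - m‖ₑ ∂μ +
            ENNReal.ofReal ((C + L) * r ^ β) * μ (gBall ρ x r) := by
          rw [lintegral_add_right _ measurable_const, setLIntegral_const]
      _ ≤ ENNReal.ofReal (A * r ^ β) * μ (gBall ρ x r) +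
            ENNReal.ofReal ((C + L) * r ^ β) * μ (gBall ρ x r) := by
          gcongr
          rw [← ofReal_measureReal hVt, ← ENNReal.ofReal_mul (by positivity),
            ← ofReal_integral_norm_eq_lintegral_enorm hi]
          exact ENNReal.ofReal_le_ofReal (hosc x r hr)
      _ = _ := by
          rw [← add_mul, ← ENNReal.ofReal_add (by positivity) (by positivity), ← add_mul])
  filter_upwards [hzero] with x hx
  exact sub_eq_zero.1 (enorm_eq_zero.1 hx)

/-- The condition through which both the commutator bound and the oscillation condition are
used. -/
theorem exists_ae_eq_memLip_nonneg [IsTopologicalGroup G] [SecondCountableTopology G]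
    [BorelSpace G] [SFinite μ] (h : IsAhlforsNorm μ ρ Q K c) {b : G → ℝ}
    (hb : LocallyIntegrable b μ) {A β : ℝ} (hA : 0 < A) (hβ : 0 < β)
    (H : ∀ z r, 0 < r → ∃ N : G → ℝ,
      (∀ᵐ x ∂μ.restrict (gBall ρ z r), ⨍ y in gBall ρ z r, |b y| ∂μ ≤ N x) ∧
      ∫⁻ x in gBall ρ z r, ‖b x - N x‖ₑ ∂μ ≤ ENNReal.ofReal (A * r ^ β) * μ (gBall ρ z r)) :
    ∃ b' : G → ℝ, b =ᵐ[μ] b' ∧ MemLip ρ β b' ∧ ∀ x, 0 ≤ b' x := by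
  have hosc : ∀ z r, 0 < r →
      ∫ x in gBall ρ z r, |b x - ⨍ y in gBall ρ z r, b y ∂μ| ∂μ ≤
        2 * A * r ^ β * μ.real (gBall ρ z r) ∧
      |⨍ y in gBall ρ z r, b y ∂μ| - ⨍ y in gBall ρ z r, b y ∂μ ≤ A * r ^ β := by
    intro z r hr
    obtain ⟨N, hN, hbN⟩ := H z r hr
    have := integral_abs_sub_average_le (h.measure_ne_zero z hr) (h.measure_ne_top z hr)
      (h.integrableOn_gBall hb z r) (by positivity) hN hbN
    rwa [← mul_assoc] at this
  obtain ⟨b', hbb', hlip, C, hC⟩ := h.exists_ae_eq_memLip hb (mul_pos two_pos hA) hβ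
    fun z r hr => (hosc z r hr).1
  refine ⟨b', hbb', hlip, fun x => ?_⟩
  -- Replacing the mean by b'(x) in |b_B| - b_B ≤ A r^β costs C r^β twice; then r tends to 0.
  have hx : |b' x| - b' x ≤ 0 := by
    refine ge_of_tendsto' (tendsto_const_mul_inv_succ_rpow (A + 2 * C) hβ) fun k => ?_
    have h1 := (hosc x (1 / ((k : ℝ) + 1)) (by positivity)).2
    have h2 := hC x (1 / ((k : ℝ) + 1)) (by positivity)
    have h3 := abs_sub_abs_le_abs_sub (b' x) (⨍ y in gBall ρ x (1 / ((k : ℝ) + 1)), b y ∂μ)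
    have h4 := neg_abs_le (b' x - ⨍ y in gBall ρ x (1 / ((k : ℝ) + 1)), b y ∂μ)
    linarith
  exact (abs_nonneg _).trans (sub_nonpos.1 hx)

end IsAhlforsNorm

/-! ### Necessity, and the equivalence for quasi-norms. -/

namespace IsAhlforsNorm

variable {G : Type*} [TopologicalSpace G] [Group G]
  [MeasurableSpace G] {μ : Measure G} {ρ : G → ℝ} {Q K c : ℝ}

/-- Serves both necessity arguments: M is a value of a local or a global maximal function for which
the ball itself is a competitor. Finiteness is essential, as `toReal` sends ∞ to 0. -/
lemma average_abs_le (h : IsAhlforsNorm μ ρ Q K c) {b : G → ℝ} (hb : LocallyIntegrable b μ)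
    {α : ℝ} (z : G) {r : ℝ} (hr : 0 < r) {M : ℝ≥0∞} (hM : M < ⊤)
    (hbM : (∫⁻ y in gBall ρ z r, ‖b y‖ₑ ∂μ) / μ (gBall ρ z r) ^ (1 - α / Q) ≤ M) :
    ⨍ y in gBall ρ z r, |b y| ∂μ ≤ (μ (gBall ρ z r)).toReal ^ (-(α / Q)) * M.toReal := by
  have hV0 := h.measure_ne_zero z hr
  have hVt := h.measure_ne_top z hr
  have hi := h.integrableOn_gBall hb z r
  have e : ⨍ y in gBall ρ z r, |b y| ∂μ =
      ((μ (gBall ρ z r))⁻¹ * ∫⁻ y in gBall ρ z r, ‖b y‖ₑ ∂μ).toReal := by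
    rw [setAverage_eq, smul_eq_mul, ENNReal.toReal_mul, ENNReal.toReal_inv, measureReal_def,
      ← integral_norm_eq_lintegral_enorm hi.aestronglyMeasurable]
    rfl
  have hWt : μ (gBall ρ z r) ^ (-(α / Q)) ≠ ⊤ := by simp [ENNReal.rpow_eq_top_iff, hV0, hVt]
  rw [e, ENNReal.toReal_rpow, ← ENNReal.toReal_mul]
  refine ENNReal.toReal_mono (ENNReal.mul_lt_top hWt.lt_top hM).ne ?_
  calc _ = μ (gBall ρ z r) ^ (-(α / Q)) * ((∫⁻ y in gBall ρ z r, ‖b y‖ₑ ∂μ) *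
        μ (gBall ρ z r) ^ (-(1 - α / Q))) := by
        rw [mul_left_comm, ← ENNReal.rpow_add _ _ hV0 hVt, mul_comm, ← ENNReal.rpow_neg_one]
        congr 2
        ring
    _ ≤ _ := by
        gcongr
        rwa [ENNReal.rpow_neg, ← div_eq_mul_inv]

lemma coe_mul_measure_rpow_le (h : IsAhlforsNorm μ ρ Q K c) (C : ℝ≥0) (β : ℝ) (z : G) {r : ℝ}
    (hr : 0 < r) : (C : ℝ≥0∞) * μ (gBall ρ z r) ^ (β / Q) ≤
      ENNReal.ofReal ((C + 1) * c ^ (β / Q) * r ^ β) := by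
  have hc := h.const_pos
  rw [h.measure_rpow z hr, Real.mul_rpow hc.le (by positivity), ← Real.rpow_mul hr.le,
    mul_div_cancel₀ _ h.dim_pos.ne', mul_assoc, ENNReal.ofReal_mul (p := (C : ℝ) + 1) (by positivity)]
  gcongr
  rw [← ENNReal.ofReal_coe_nnreal]
  exact ENNReal.ofReal_le_ofReal (by linarith)

theorem exists_ae_eq_memLip_nonneg_of_oscillationCondition [IsTopologicalGroup G]
    [SecondCountableTopology G] [BorelSpace G] [SFinite μ] (h : IsAhlforsNorm μ ρ Q K c)
    {b : G → ℝ} (hb : LocallyIntegrable b μ) {α β s : ℝ} (hβ : 0 < β) (hs : 1 ≤ s)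
    (H : OscillationCondition μ ρ Q α β s b) :
    ∃ b' : G → ℝ, b =ᵐ[μ] b' ∧ MemLip ρ β b' ∧ ∀ x, 0 ≤ b' x := by
  have hc := h.const_pos
  have hs0 : 0 < s := by linarith
  obtain ⟨hfin, hsup⟩ := H
  set C := (⨆ (z : G) (r : ℝ) (_ : 0 < r), maximalOscillation μ ρ Q α β s b (gBall ρ z r)).toNNReal
    with hC
  have hosc : ∀ z r, 0 < r → maximalOscillation μ ρ Q α β s b (gBall ρ z r) ≤ C := by
    intro z r hr
    rw [hC, ENNReal.coe_toNNReal hsup.ne]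
    exact le_iSup₂_of_le z r (le_iSup_of_le hr le_rfl)
  refine h.exists_ae_eq_memLip_nonneg hb (A := (C + 1) * c ^ (β / Q)) (by positivity) hβ
    fun z r hr => ?_
  have hV0 := h.measure_ne_zero z hr
  have hVt := h.measure_ne_top z hr
  -- The function from which the oscillation condition measures the deviation of b. Hölder lowers
  -- the exponent s to 1.
  set N : G → ℝ := fun x => (μ (gBall ρ z r)).toReal ^ (-(α / Q)) *
    (localFracMaximal μ ρ Q α (gBall ρ z r) b x).toReal with hN
  refine ⟨N, ?_, ?_⟩
  · filter_upwards [hfin z r hr, ae_restrict_mem (h.measurableSet_gBall z r)] with x hx hxB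
    exact h.average_abs_le hb z hr hx (le_localFracMaximal α b hr hxB subset_rfl)
  · have hNm : Measurable N :=
      (h.measurable_localFracMaximal α (gBall ρ z r) b).ennreal_toReal.const_mul _
    have hbN : AEStronglyMeasurable (fun x => b x - N x) μ :=
      hb.aestronglyMeasurable.sub hNm.aestronglyMeasurable
    refine (setLIntegral_enorm_le_eLpNorm_mul_rpow _ hbN.restrict hs).trans ?_
    rw [eLpNorm_ofReal_eq _ hs0]
    have h1 := hosc z r hr
    unfold maximalOscillation at h1
    set J := ∫⁻ x in gBall ρ z r, ‖b x - N x‖ₑ ^ s ∂μ with hJ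
    set V := μ (gBall ρ z r) with hV
    rw [ENNReal.mul_rpow_of_nonneg _ _ (by positivity), ENNReal.inv_rpow, ← ENNReal.rpow_neg] at h1
    calc J ^ (1 / s) * V ^ (1 - 1 / s)
        = V ^ (-(β / Q)) * (V ^ (-(1 / s)) * J ^ (1 / s)) * V ^ (β / Q) * V := by
          nth_rewrite 5 [← ENNReal.rpow_one V]
          have : J ^ (1 / s) * (V ^ (-(β / Q)) * V ^ (-(1 / s)) * V ^ (β / Q) * V ^ (1 : ℝ)) =
              J ^ (1 / s) * V ^ (1 - 1 / s) := by
            rw [← ENNReal.rpow_add _ _ hV0 hVt, ← ENNReal.rpow_add _ _ hV0 hVt,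
              ← ENNReal.rpow_add _ _ hV0 hVt]
            congr 2
            ring
          rw [← this]
          ring
      _ ≤ C * V ^ (β / Q) * V := by gcongr
      _ ≤ _ := by
          gcongr
          exact h.coe_mul_measure_rpow_le C β z hr

/-- The intersection with a competing ball is at most the smaller of the two measures. Both
exponents α/Q and 1 - α/Q are nonnegative, so the original ball is optimal. -/
lemma fracMaximal_indicator_one [IsTopologicalGroup G] [BorelSpace G]
    (h : IsAhlforsNorm μ ρ Q K c) {α : ℝ} (hα : 0 ≤ α) (hαQ : α ≤ Q) {x z : G} {r : ℝ}
    (hr : 0 < r) (hx : x ∈ gBall ρ z r) :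
    fracMaximal μ ρ Q α ((gBall ρ z r).indicator fun _ => 1) x = μ (gBall ρ z r) ^ (α / Q) := by
  have hQ := h.dim_pos
  have h1 : 0 ≤ 1 - α / Q := sub_nonneg.2 ((div_le_one hQ).2 hαQ)
  have h0 : 0 ≤ α / Q := by positivity
  have hint : ∀ w t, ∫⁻ y in gBall ρ w t, ‖(gBall ρ z r).indicator (fun _ => (1 : ℝ)) y‖ₑ ∂μ =
      μ (gBall ρ z r ∩ gBall ρ w t) := by
    intro w t
    rw [← Measure.restrict_apply (h.measurableSet_gBall z r),
      ← lintegral_indicator_one (h.measurableSet_gBall z r)]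
    refine lintegral_congr fun y => ?_
    by_cases hy : y ∈ gBall ρ z r <;> simp [hy]
  refine le_antisymm (fracMaximal_le fun w t ht _ => ?_) ?_
  · rw [hint]
    rcases le_total (μ (gBall ρ w t)) (μ (gBall ρ z r)) with hV | hV
    · calc _ ≤ μ (gBall ρ w t) / μ (gBall ρ w t) ^ (1 - α / Q) := by
            gcongr; exact inter_subset_right
        _ = μ (gBall ρ w t) ^ (α / Q) := h.measure_div_rpow α w ht
        _ ≤ _ := by gcongr
    · calc _ ≤ μ (gBall ρ z r) / μ (gBall ρ z r) ^ (1 - α / Q) := by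
            gcongr; exact inter_subset_left
        _ = _ := h.measure_div_rpow α z hr
  · rw [← h.measure_div_rpow α z hr]
    have := le_fracMaximal (μ := μ) (Q := Q) α ((gBall ρ z r).indicator fun _ => 1) hr hx
    rwa [hint, inter_self] at this

/-- Test on the indicator f of B. On B one has M_α f = |B|^(α/Q), so |B|^(-α/Q) [b, M_α] f equals b
- N with N = |B|^(-α/Q) M_α (bf). -/
theorem exists_ae_eq_memLip_nonneg_of_commutatorBounded [IsTopologicalGroup G]
    [SecondCountableTopology G] [BorelSpace G] [SFinite μ] (h : IsAhlforsNorm μ ρ Q K c)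
    {b : G → ℝ} (hb : LocallyIntegrable b μ) {α β p q : ℝ} (hα : 0 ≤ α) (hαQ : α ≤ Q) (hβ : 0 < β)
    (hp : 1 < p) (hpQ : p < Q / (α + β)) (hq : 1 / q = 1 / p - (α + β) / Q)
    (H : CommutatorBounded μ ρ Q α b p q) :
    ∃ b' : G → ℝ, b =ᵐ[μ] b' ∧ MemLip ρ β b' ∧ ∀ x, 0 ≤ b' x := by
  have hc := h.const_pos
  have hQ := h.dim_pos
  have hp0 : 0 < p := by linarith
  have hαβ : 0 < α + β := by linarith
  have hpαβ : 0 < 1 / p - (α + β) / Q := by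
    rw [sub_pos, div_lt_div_iff₀ hQ hp0, one_mul]
    rwa [lt_div_iff₀ hαβ, mul_comm] at hpQ
  have hq0 : 0 < q := by rw [← one_div_pos, hq]; exact hpαβ
  have hpq : p ≤ q := by
    rw [← one_div_le_one_div hq0 hp0, hq]
    have : 0 < (α + β) / Q := by positivity
    linarith
  obtain ⟨C, hC⟩ := H
  refine h.exists_ae_eq_memLip_nonneg hb (A := (C + 1) * c ^ (β / Q)) (by positivity) hβ
    fun z r hr => ?_
  have hBm := h.measurableSet_gBall z r
  have hV0 := h.measure_ne_zero z hr
  have hVt := h.measure_ne_top z hr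
  set f : G → ℝ := (gBall ρ z r).indicator fun _ => 1 with hf
  obtain ⟨hfin, hmem, hle⟩ := hC f (memLp_indicator_const _ hBm 1 (Or.inr hVt))
  rw [eLpNorm_indicator_const hBm (by simpa using hp0) ENNReal.ofReal_ne_top, enorm_one, one_mul,
    ENNReal.toReal_ofReal hp0.le] at hle
  set N : G → ℝ := fun x => (μ (gBall ρ z r)).toReal ^ (-(α / Q)) *
    (fracMaximal μ ρ Q α (fun y => b y * f y) x).toReal with hN
  refine ⟨N, ?_, ?_⟩
  · filter_upwards [ae_restrict_of_ae hfin, ae_restrict_mem hBm] with x hx hxB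
    refine h.average_abs_le hb z hr hx.2 ?_
    refine le_trans (le_of_eq ?_) (le_fracMaximal α (fun y => b y * f y) hr hxB)
    congr 1
    refine setLIntegral_congr_fun hBm fun y hy => ?_
    simp [hf, hy]
  · have e : ∀ x ∈ gBall ρ z r, ‖b x - N x‖ₑ =
        μ (gBall ρ z r) ^ (-(α / Q)) * ‖maximalCommutator μ ρ Q α b f x‖ₑ := by
      intro x hx
      have hVr : 0 < (μ (gBall ρ z r)).toReal := ENNReal.toReal_pos hV0 hVt
      have hW : μ (gBall ρ z r) ^ (-(α / Q)) =
          ‖(μ (gBall ρ z r)).toReal ^ (-(α / Q))‖ₑ := by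
        rw [Real.enorm_eq_ofReal (by positivity), ← ENNReal.ofReal_rpow_of_pos hVr,
          ENNReal.ofReal_toReal hVt]
      rw [hW, ← enorm_mul, maximalCommutator, h.fracMaximal_indicator_one hα hαQ hr hx,
        ← ENNReal.toReal_rpow, mul_sub, mul_left_comm, ← Real.rpow_add hVr]
      simp [hN]
    calc ∫⁻ x in gBall ρ z r, ‖b x - N x‖ₑ ∂μ
        = ∫⁻ x in gBall ρ z r,
            μ (gBall ρ z r) ^ (-(α / Q)) * ‖maximalCommutator μ ρ Q α b f x‖ₑ ∂μ :=
          setLIntegral_congr_fun hBm e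
      _ = μ (gBall ρ z r) ^ (-(α / Q)) *
            ∫⁻ x in gBall ρ z r, ‖maximalCommutator μ ρ Q α b f x‖ₑ ∂μ :=
          lintegral_const_mul' _ _ (by simp [ENNReal.rpow_eq_top_iff, hV0, hVt])
      _ ≤ μ (gBall ρ z r) ^ (-(α / Q)) *
            (C * μ (gBall ρ z r) ^ (1 / p) * μ (gBall ρ z r) ^ (1 - 1 / q)) := by
          gcongr
          refine (setLIntegral_enorm_le_eLpNorm_mul_rpow _ hmem.1.restrict
            (hp.le.trans hpq)).trans ?_
          gcongr
          exact (eLpNorm_mono_measure _ Measure.restrict_le_self).trans hle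
      _ = C * μ (gBall ρ z r) ^ (β / Q) * μ (gBall ρ z r) := by
          -- The relation between p and q enters here: -α/Q + 1/p + 1 - 1/q = 1 + β/Q.
          have : μ (gBall ρ z r) ^ (-(α / Q)) * μ (gBall ρ z r) ^ (1 / p) *
              μ (gBall ρ z r) ^ (1 - 1 / q) = μ (gBall ρ z r) ^ (β / Q) * μ (gBall ρ z r) := by
            nth_rewrite 5 [← ENNReal.rpow_one (μ (gBall ρ z r))]
            simp only [← ENNReal.rpow_add _ _ hV0 hVt]
            congr 1
            rw [hq]; ring
          rw [mul_assoc (C : ℝ≥0∞) (μ (gBall ρ z r) ^ (β / Q)), ← this]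
          ring
      _ ≤ _ := by
          gcongr
          exact h.coe_mul_measure_rpow_le C β z hr

theorem tfae_memLip_commutatorBounded_oscillationCondition [IsTopologicalGroup G]
    [SecondCountableTopology G] [BorelSpace G] [SFinite μ] (h : IsAhlforsNorm μ ρ Q K c)
    {α β : ℝ} (hα : 0 < α) (hβ : 0 < β) (hαβ : α + β < Q)
    {b : G → ℝ} (hb : LocallyIntegrable b μ) :
    List.TFAE [
      (∃ b' : G → ℝ, b =ᵐ[μ] b' ∧ MemLip ρ β b' ∧ ∀ x, 0 ≤ b' x),
      (∀ p q : ℝ, 1 < p → p < Q / (α + β) → 1 / q = 1 / p - (α + β) / Q →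
        CommutatorBounded μ ρ Q α b p q),
      (∃ p q : ℝ, 1 < p ∧ p < Q / (α + β) ∧ 1 / q = 1 / p - (α + β) / Q ∧
        CommutatorBounded μ ρ Q α b p q),
      (∃ s : ℝ, 1 ≤ s ∧ OscillationCondition μ ρ Q α β s b),
      (∀ s : ℝ, 1 ≤ s → OscillationCondition μ ρ Q α β s b)] := by
  tfae_have 1 → 2 := by
    rintro ⟨b', hbb', hlip, hb0⟩ p q hp hpQ hq
    exact (h.commutatorBounded hα.le hβ hlip hb0 hp hpQ hq).congr_ae hbb'
  tfae_have 2 → 3 := by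
    intro H
    have h1 : 1 < Q / (α + β) := (one_lt_div (by linarith)).2 hαβ
    obtain ⟨p, hp, hpQ⟩ := exists_between h1
    refine ⟨p, (1 / p - (α + β) / Q)⁻¹, hp, hpQ, by simp, H p _ hp hpQ (by simp)⟩
  tfae_have 3 → 1 := by
    rintro ⟨p, q, hp, hpQ, hq, H⟩
    exact h.exists_ae_eq_memLip_nonneg_of_commutatorBounded hb hα.le (by linarith) hβ hp hpQ hq H
  tfae_have 1 → 5 := by
    rintro ⟨b', hbb', hlip, hb0⟩ s hs
    exact (h.oscillationCondition hα.le hβ (by linarith) hlip hb0).congr_ae hbb'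
  tfae_have 5 → 4 := fun H => ⟨1, le_rfl, H 1 le_rfl⟩
  tfae_have 4 → 1 := by
    rintro ⟨s, hs, H⟩
    exact h.exists_ae_eq_memLip_nonneg_of_oscillationCondition hb hβ hs H
  tfae_finish

end IsAhlforsNorm

/-! ### Linear dilations of a graded vector space. -/

section Graded

variable {W : Type*} [NormedAddCommGroup W] [NormedSpace ℝ W]
  {V : ℕ → Submodule ℝ W} {m : ℕ}

/-- A basis adapted to a grading, in which the dilations are diagonal. -/
def gradedBasis [FiniteDimensional ℝ W] (hV : DirectSum.IsInternal V) :
    Module.Basis (Σ k, Fin (Module.finrank ℝ (V k))) ℝ W :=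
  hV.collectedBasis fun k => Module.finBasis ℝ (V k)

lemma gradedBasis_mem [FiniteDimensional ℝ W] (hV : DirectSum.IsInternal V)
    (i : Σ k, Fin (Module.finrank ℝ (V k))) :
    gradedBasis hV i ∈ V i.1 := by
  rw [gradedBasis, hV.collectedBasis_coe]
  exact Subtype.prop _

lemma mem_Icc_of_gradedBasis_index (hbot : ∀ j, j ∉ Finset.Icc 1 m → V j = ⊥)
    (i : Σ k, Fin (Module.finrank ℝ (V k))) : i.1 ∈ Finset.Icc 1 m := by
  by_contra hi
  obtain ⟨k, l⟩ := i
  have h0 : Module.finrank ℝ (V k) = 0 := by rw [hbot k hi]; simp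
  exact (Fin.cast h0 l).elim0

/-- In an adapted basis D is diagonal, with r^k repeated dim V_k times. This is the source of the
homogeneous dimension. -/
lemma det_dilation [FiniteDimensional ℝ W] (hV : DirectSum.IsInternal V)
    (hbot : ∀ j, j ∉ Finset.Icc 1 m → V j = ⊥)
    {r : ℝ} {D : W →ₗ[ℝ] W} (hD : ∀ k, ∀ X ∈ V k, D X = r ^ k • X) :
    LinearMap.det D = r ^ ∑ j ∈ Finset.Icc 1 m, j * Module.finrank ℝ (V j) := by
  classical
  let : Fintype (Σ k, Fin (Module.finrank ℝ (V k))) :=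
    FiniteDimensional.fintypeBasisIndex (gradedBasis hV)
  have hmat : LinearMap.toMatrix (gradedBasis hV) (gradedBasis hV) D =
      Matrix.diagonal fun i => r ^ i.1 := by
    ext i j
    rw [LinearMap.toMatrix_apply, hD _ _ (gradedBasis_mem hV j)]
    rcases eq_or_ne i j with rfl | hij
    · simp
    · simp [hij]
  have huniv : (Finset.univ : Finset (Σ k, Fin (Module.finrank ℝ (V k)))) =
      (Finset.Icc 1 m).sigma fun _ => Finset.univ := by
    ext i
    simpa using Finset.mem_Icc.1 (mem_Icc_of_gradedBasis_index hbot i)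
  rw [← LinearMap.det_toMatrix (gradedBasis hV), hmat, Matrix.det_diagonal, Finset.prod_pow_eq_pow_sum,
    huniv, Finset.sum_sigma]
  congr 1
  refine Finset.sum_congr rfl fun k _ => ?_
  simp [mul_comm]

/-- All weights are at least 1, so r^k ≤ r when 0 ≤ r ≤ 1. The constant depends only on the adapted
basis; adding 1 keeps it positive when W = 0. -/
lemma exists_norm_dilation_le [FiniteDimensional ℝ W] (hV : DirectSum.IsInternal V)
    (hbot : ∀ j, j ∉ Finset.Icc 1 m → V j = ⊥) :
    ∃ C : ℝ, 0 < C ∧ ∀ r : ℝ, 0 ≤ r → r ≤ 1 → ∀ D : W →L[ℝ] W,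
      (∀ k, ∀ X ∈ V k, D X = r ^ k • X) → ‖D‖ ≤ C * r := by
  let : Fintype (Σ k, Fin (Module.finrank ℝ (V k))) :=
    FiniteDimensional.fintypeBasisIndex (gradedBasis hV)
  set B := gradedBasis hV with hB
  set C := ∑ i, ‖(B.coord i).toContinuousLinearMap‖ * ‖B i‖ with hC
  have hC0 : 0 ≤ C := Finset.sum_nonneg fun i _ => by positivity
  refine ⟨C + 1, by positivity, fun r hr0 hr1 D hD => ?_⟩
  refine D.opNorm_le_bound (by positivity) fun x => ?_
  have hx : D x = ∑ i, B.coord i x • r ^ i.1 • B i := by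
    conv_lhs => rw [← B.sum_repr x]
    rw [map_sum]
    refine Finset.sum_congr rfl fun i _ => ?_
    rw [map_smul, hD _ _ (gradedBasis_mem hV i)]
    rfl
  rw [hx]
  calc ‖∑ i, B.coord i x • r ^ i.1 • B i‖
      ≤ ∑ i, ‖B.coord i x • r ^ i.1 • B i‖ := norm_sum_le _ _
    _ ≤ ∑ i, ‖(B.coord i).toContinuousLinearMap‖ * ‖B i‖ * (r * ‖x‖) := by
        refine Finset.sum_le_sum fun i _ => ?_
        rw [norm_smul, norm_smul, norm_pow, Real.norm_of_nonneg hr0]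
        have h1 : ‖B.coord i x‖ ≤ ‖(B.coord i).toContinuousLinearMap‖ * ‖x‖ :=
          (B.coord i).toContinuousLinearMap.le_opNorm x
        have h2 : r ^ i.1 ≤ r := pow_le_of_le_one hr0 hr1
          (by have := Finset.mem_Icc.1 (mem_Icc_of_gradedBasis_index hbot i); omega)
        calc _ ≤ ‖(B.coord i).toContinuousLinearMap‖ * ‖x‖ * (r * ‖B i‖) := by gcongr
          _ = _ := by ring
    _ = C * (r * ‖x‖) := by rw [← Finset.sum_mul]
    _ ≤ _ := by
        rw [mul_assoc]
        gcongr
        linarith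

end Graded

/-! ### Contracting automorphisms and bounded sublevel sets. -/

section Contraction

variable {G : Type*} [TopologicalSpace G] [Group G]

/-- In a connected group, an endomorphism whose iterates contract a neighborhood of `1` to `1`
contracts every point to `1`. -/
lemma tendsto_iterate_one [IsTopologicalGroup G] [PreconnectedSpace G] (φ : G →* G) {K : Set G}
    (hK : K ∈ 𝓝 (1 : G))
    (hφ : ∀ x ∈ K, Tendsto (fun k => φ^[k] x) atTop (𝓝 1)) (x : G) :
    Tendsto (fun k => φ^[k] x) atTop (𝓝 1) := by
  -- The contracted points form a subgroup. Containing a neighborhood of 1, it is open, hence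
  -- closed, hence everything.
  let H : Subgroup G :=
    { carrier := {x | Tendsto (fun k => φ^[k] x) atTop (𝓝 1)}
      mul_mem' := fun {a b} ha hb => by
        have : Tendsto (fun k => φ^[k] a * φ^[k] b) atTop (𝓝 (1 * 1)) := Tendsto.mul ha hb
        rw [mul_one] at this
        exact this.congr fun k => (iterate_map_mul φ k a b).symm
      one_mem' := by
        show Tendsto (fun k => φ^[k] 1) atTop (𝓝 1)
        simp only [iterate_map_one]
        exact tendsto_const_nhds
      inv_mem' := fun {a} ha => by
        have : Tendsto (fun k => (φ^[k] a)⁻¹) atTop (𝓝 1⁻¹) := Tendsto.inv ha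
        rw [inv_one] at this
        exact this.congr fun k => (iterate_map_inv φ k a).symm }
  have hO : IsOpen (H : Set G) := H.isOpen_of_mem_nhds (mem_of_superset hK hφ)
  have : (H : Set G) = univ := IsClopen.eq_univ ⟨H.isClosed_of_isOpen hO, hO⟩ ⟨1, H.one_mem⟩
  exact (this ▸ mem_univ x : x ∈ (H : Set G))

/-- On the compact set K \ φ(U), which misses 1, ρ has a positive lower bound a. The orbit of a
point outside K enters K, and at its first entrance it lies in K \ φ(U), because the preceding point
is outside K ⊇ U. Since ρ does not increase along the orbit, the starting point has ρ ≥ a. -/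
lemma exists_sublevel_subset [IsTopologicalGroup G] [PreconnectedSpace G] {φ : G ≃* G}
    (hφo : IsOpenMap φ) {K U : Set G} (hK : IsCompact K) (hU : IsOpen U) (h1 : 1 ∈ U) (hUK : U ⊆ K)
    (hφ : ∀ x ∈ K, Tendsto (fun k => φ^[k] x) atTop (𝓝 1)) {ρ : G → ℝ} (hρ : Continuous ρ)
    (hpos : ∀ x, x ≠ 1 → 0 < ρ x) (hρφ : ∀ x, ρ (φ x) ≤ ρ x) :
    ∃ a, 0 < a ∧ ∀ x, ρ x < a → x ∈ K := by
  have hφU : IsOpen (φ '' U) := hφo U hU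
  obtain ⟨a, ha, haK⟩ := (hK.diff hφU).exists_forall_le' hρ.continuousOn (a := 0) fun x hx =>
    hpos x fun h => hx.2 ⟨1, h1, by rw [map_one, h]⟩
  refine ⟨a, ha, fun x hx => ?_⟩
  by_contra hxK
  have hKn : K ∈ 𝓝 (1 : G) := mem_of_superset (hU.mem_nhds h1) hUK
  have hex : ∃ k, φ^[k] x ∈ K :=
    ((tendsto_iterate_one φ.toMonoidHom hKn hφ x).eventually_mem hKn).exists
  classical
  obtain ⟨k, hk⟩ : ∃ k, Nat.find hex = k + 1 := by
    refine Nat.exists_eq_succ_of_ne_zero fun h0 => ?_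
    have := Nat.find_spec hex
    rw [h0] at this
    exact hxK this
  have hmem := Nat.find_spec hex
  have hnot := Nat.find_min hex (m := k) (by omega)
  rw [hk, Function.iterate_succ_apply'] at hmem
  have hle : ∀ j, ρ (φ^[j] x) ≤ ρ x := by
    intro j
    induction j with
    | zero => exact le_rfl
    | succ j ih =>
      rw [Function.iterate_succ_apply']
      exact (hρφ _).trans ih
  have h2 := haK (φ (φ^[k] x)) ⟨hmem, by
    rintro ⟨u, hu, huk⟩
    exact hnot (φ.injective huk ▸ hUK hu)⟩
  have := (hρφ _).trans (hle k)
  linarith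

/-- In a local chart at `1`, an endomorphism with small derivative contracts a neighborhood. -/
lemma exists_contracting_nhds {E : Type*} [NormedAddCommGroup E] [NormedSpace ℝ E]
    [FiniteDimensional ℝ E] (e : OpenPartialHomeomorph G E) (he : (1 : G) ∈ e.source) (φ : G →* G)
    (hφ : Continuous φ) {D : E →L[ℝ] E}
    (hD : HasStrictFDerivAt (fun v => e (φ (e.symm v))) D (e 1)) (hD4 : ‖D‖ ≤ 1 / 4) :
    ∃ K U : Set G, IsCompact K ∧ IsOpen U ∧ 1 ∈ U ∧ U ⊆ K ∧
      ∀ x ∈ K, Tendsto (fun k => φ^[k] x) atTop (𝓝 1) := by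
  obtain ⟨s, hs, happ⟩ := hD.approximates_deriv_on_nhds (c := 1 / 4) (Or.inr (by norm_num))
  have het : e 1 ∈ e.target := e.map_source he
  have hcont : Tendsto (fun v => φ (e.symm v)) (𝓝 (e 1)) (𝓝 1) := by
    have h2 : Tendsto φ (𝓝 1) (𝓝 1) := by simpa using hφ.tendsto 1
    exact h2.comp (e.tendsto_symm he)
  obtain ⟨ε, hε, hball⟩ := Metric.nhds_basis_closedBall.mem_iff.1
    (inter_mem hs (inter_mem (e.open_target.mem_nhds het)
      (hcont (e.open_source.mem_nhds he))))
  have hsub : Metric.closedBall (e 1) ε ⊆ e.target := fun v hv => (hball hv).2.1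
  -- The factor 1/2 is 1/4 from the norm of D plus 1/4 from the linearization error.
  have hstep : ∀ v ∈ Metric.closedBall (e 1) ε,
      ‖e (φ (e.symm v)) - e 1‖ ≤ 1 / 2 * ‖v - e 1‖ := by
    intro v hv
    have h1 := happ _ (hball hv).1 _ (hball (Metric.mem_closedBall_self hε.le)).1
    simp only [e.left_inv he, map_one] at h1
    have h2 := D.le_opNorm (v - e 1)
    have h3 : e (φ (e.symm v)) - e 1 = (e (φ (e.symm v)) - e 1 - D (v - e 1)) + D (v - e 1) := by
      abel
    rw [h3]
    refine (norm_add_le _ _).trans ?_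
    have h4 : ‖D‖ * ‖v - e 1‖ ≤ 1 / 4 * ‖v - e 1‖ := by gcongr
    have h5 : (((1 / 4 : ℝ≥0) : ℝ)) = 1 / 4 := by norm_num
    rw [h5] at h1
    linarith
  refine ⟨e.symm '' Metric.closedBall (e 1) ε, e.symm '' Metric.ball (e 1) ε,
    (isCompact_closedBall _ _).image_of_continuousOn (e.continuousOn_symm.mono hsub),
    e.symm.isOpen_image_of_subset_source Metric.isOpen_ball (Metric.ball_subset_closedBall.trans hsub),
    ⟨e 1, Metric.mem_ball_self hε, e.left_inv he⟩, image_mono Metric.ball_subset_closedBall, ?_⟩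
  rintro _ ⟨v, hv, rfl⟩
  have key : ∀ k : ℕ, ∃ w, φ^[k] (e.symm v) = e.symm w ∧ ‖w - e 1‖ ≤ (1 / 2) ^ k * ε := by
    intro k
    induction k with
    | zero => exact ⟨v, rfl, by simpa [dist_eq_norm] using hv⟩
    | succ k ih =>
      obtain ⟨w, hw, hwn⟩ := ih
      have hwb : w ∈ Metric.closedBall (e 1) ε := by
        rw [mem_closedBall_iff_norm]
        exact hwn.trans (mul_le_of_le_one_left hε.le (pow_le_one₀ (by norm_num) (by norm_num)))
      refine ⟨e (φ (e.symm w)), ?_, ?_⟩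
      · rw [Function.iterate_succ_apply', hw, e.left_inv (hball hwb).2.2]
      · refine (hstep w hwb).trans ?_
        rw [pow_succ']
        nlinarith
  choose w hw hwn using key
  have hlim : Tendsto w atTop (𝓝 (e 1)) := by
    refine tendsto_iff_norm_sub_tendsto_zero.2 (squeeze_zero (fun _ => norm_nonneg _) hwn ?_)
    simpa using (tendsto_pow_atTop_nhds_zero_of_lt_one (r := (1 / 2 : ℝ)) (by norm_num)
      (by norm_num)).mul_const ε
  simp only [hw]
  exact (e.tendsto_symm he).comp hlim

end Contraction

/-! ### Haar measure in a chart and the scaling factor of an automorphism. -/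

/-- If m < a, then C (m/a)^j tends to 0 while staying at least 1. This removes the constants
comparing Haar with Lebesgue measure. -/
lemma NNReal.le_of_forall_pow_le_const_mul {a m : ℝ≥0} {C : ℝ≥0} (h : ∀ j : ℕ, a ^ j ≤ C * m ^ j) :
    a ≤ m := by
  by_contra! hlt
  have ha : 0 < a := zero_le.trans_lt hlt
  have h1 : ∀ j : ℕ, 1 ≤ C * (m / a) ^ j := fun j => by
    rw [div_pow, mul_div_assoc', le_div_iff₀ (by positivity), one_mul]
    exact h j
  have h2 : Tendsto (fun j : ℕ => C * (m / a) ^ j) atTop (𝓝 0) := by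
    simpa using (tendsto_pow_atTop_nhds_zero_of_lt_one ((div_lt_one ha).2 hlt)).const_mul C
  exact absurd (ge_of_tendsto' h2 h1) (by simp)

section Chart

variable {G : Type*} [TopologicalSpace G] [Group G]
  {E : Type*} [NormedAddCommGroup E] [NormedSpace ℝ E]

/-- In a chart at `1`, the left translations by elements close to `1` are close to the identity. -/
lemma exists_nhds_approximatesLinearOn_mul (e : OpenPartialHomeomorph G E) (he : (1 : G) ∈ e.source)
    {F' : E × E →L[ℝ] E}
    (hF : HasStrictFDerivAt (fun z : E × E => e (e.symm z.1 * e.symm z.2)) F' (e 1, e 1))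
    {δ : ℝ≥0} (hδ : 0 < δ) :
    ∃ O ∈ 𝓝 (e 1), ∀ a ∈ O, ApproximatesLinearOn (fun v => e (e.symm a * e.symm v))
      (ContinuousLinearMap.id ℝ E) O δ := by
  -- Left translation by 1 is the identity, so the partial derivative in the second variable is the
  -- identity.
  have hid : F'.comp (ContinuousLinearMap.inr ℝ E E) = ContinuousLinearMap.id ℝ E := by
    have h1 : HasFDerivAt (fun v => e (e.symm (e 1) * e.symm v))
        (F'.comp (ContinuousLinearMap.inr ℝ E E)) (e 1) :=
      HasFDerivAt.comp (g := fun z : E × E => e (e.symm z.1 * e.symm z.2)) (e 1) hF.hasFDerivAt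
        (hasFDerivAt_prodMk_right (e 1) (e 1))
    have h2 : (fun v => e (e.symm (e 1) * e.symm v)) =ᶠ[𝓝 (e 1)] id := by
      filter_upwards [e.open_target.mem_nhds (e.map_source he)] with v hv
      simp [e.left_inv he, e.right_inv hv]
    exact h1.unique ((hasFDerivAt_id (e 1)).congr_of_eventuallyEq h2)
  obtain ⟨s, hs, happ⟩ := hF.approximates_deriv_on_nhds (Or.inr hδ)
  obtain ⟨O₁, hO₁, O₂, hO₂, hsub⟩ := mem_nhds_prod_iff.1 hs
  refine ⟨O₁ ∩ O₂, inter_mem hO₁ hO₂, fun a ha v hv w hw => ?_⟩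
  have h1 := happ (a, v) (hsub ⟨ha.1, hv.2⟩) (a, w) (hsub ⟨ha.1, hw.2⟩)
  have h2 : F' ((a, v) - (a, w)) = v - w := by
    have := congrArg (fun T : E →L[ℝ] E => T (v - w)) hid
    simpa using this
  rw [h2] at h1
  simpa [Prod.norm_def] using h1

end Chart

section HaarChart

variable {G : Type*} [TopologicalSpace G] [Group G] [IsTopologicalGroup G] [LocallyCompactSpace G]
  [SecondCountableTopology G] [MeasurableSpace G] [BorelSpace G]
  {E : Type*} [NormedAddCommGroup E] [NormedSpace ℝ E] [FiniteDimensional ℝ E]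
  [MeasurableSpace E] [BorelSpace E]

/-- Haar measure and Lebesgue measure in a chart are comparable on small symmetric sets. -/
lemma exists_measure_chart_comparable (μ : Measure G) [μ.IsHaarMeasure] (ν : Measure E)
    [ν.IsAddHaarMeasure] (e : OpenPartialHomeomorph G E) (he : (1 : G) ∈ e.source)
    {F' : E × E →L[ℝ] E}
    (hF : HasStrictFDerivAt (fun z : E × E => e (e.symm z.1 * e.symm z.2)) F' (e 1, e 1)) :
    ∃ W ∈ 𝓝 (1 : G), W ⊆ e.source ∧ ∃ c₁ c₂ : ℝ≥0∞, c₁ ≠ ⊤ ∧ c₂ ≠ ⊤ ∧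
      ∀ A ⊆ W, MeasurableSet A → A⁻¹ = A → ν (e '' A) ≤ c₁ * μ A ∧ μ A ≤ c₂ * ν (e '' A) := by
  have het : e 1 ∈ e.target := e.map_source he
  have hdet : (ContinuousLinearMap.id ℝ E).det = 1 := by simp [ContinuousLinearMap.det]
  obtain ⟨δ, ⟨hup, hlow⟩, hδ⟩ := (((addHaar_image_le_mul_of_det_lt ν (ContinuousLinearMap.id ℝ E)
    (m := 2) (by rw [hdet]; norm_num)).and (mul_le_addHaar_image_of_lt_det ν
    (ContinuousLinearMap.id ℝ E) (m := 2⁻¹) (by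
      rw [hdet, ENNReal.coe_inv two_ne_zero]; simp))).and self_mem_nhdsWithin).exists
  obtain ⟨O, hO, happ⟩ := exists_nhds_approximatesLinearOn_mul e he hF hδ
  obtain ⟨R, hR, hRt⟩ := Metric.isOpen_iff.1 e.open_target (e 1) het
  set T := Metric.ball (e 1) R with hT
  obtain ⟨C, hC, hC1⟩ := exists_compact_mem_nhds (1 : G)
  have hN1 : e.source ∩ e ⁻¹' T ∈ 𝓝 (1 : G) :=
    inter_mem (e.open_source.mem_nhds he)
      ((e.continuousAt he).preimage_mem_nhds (Metric.ball_mem_nhds _ hR))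
  have hmulT : Tendsto (fun z : E × E => e.symm z.1 * e.symm z.2) (𝓝 (e 1) ×ˢ 𝓝 (e 1)) (𝓝 1) := by
    have h1 : Tendsto (fun z : E × E => e.symm z.1) (𝓝 (e 1) ×ˢ 𝓝 (e 1)) (𝓝 1) :=
      (e.tendsto_symm he).comp tendsto_fst
    have h2 : Tendsto (fun z : E × E => e.symm z.2) (𝓝 (e 1) ×ˢ 𝓝 (e 1)) (𝓝 1) :=
      (e.tendsto_symm he).comp tendsto_snd
    simpa using h1.mul h2
  obtain ⟨P, hP, hPsub⟩ := Filter.mem_prod_same_iff.1 (hmulT hN1)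
  obtain ⟨s, hs, hssub⟩ := Metric.mem_nhds_iff.1 (inter_mem (inter_mem hO hP)
    (inter_mem (Metric.ball_mem_nhds (e 1) hR) (e.tendsto_symm he hC1)))
  set U := e.symm '' Metric.ball (e 1) s with hU
  have hst : Metric.ball (e 1) s ⊆ e.target := fun v hv => hRt (hssub hv).2.1
  have hUo : IsOpen U := e.symm.isOpen_image_of_subset_source Metric.isOpen_ball hst
  have h1U : (1 : G) ∈ U := ⟨e 1, Metric.mem_ball_self hs, e.left_inv he⟩
  have hUb : ∀ x ∈ U, x ∈ e.source ∧ e x ∈ Metric.ball (e 1) s := by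
    rintro _ ⟨v, hv, rfl⟩
    exact ⟨e.map_target (hst hv), by rwa [e.right_inv (hst hv)]⟩
  have hUT : ∀ x ∈ U, ∀ y ∈ U, x * y ∈ e.source ∩ e ⁻¹' T := by
    intro x hx y hy
    obtain ⟨hx1, hx2⟩ := hUb x hx
    obtain ⟨hy1, hy2⟩ := hUb y hy
    have := hPsub (mk_mem_prod (hssub hx2).1.2 (hssub hy2).1.2)
    simpa only [mem_preimage, e.left_inv hx1, e.left_inv hy1] using this
  have hμU : μ U ≠ ⊤ := by
    refine ((measure_mono ?_).trans_lt hC.measure_lt_top).ne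
    rintro _ ⟨v, hv, rfl⟩
    exact (hssub hv).2.2
  have hμU0 : μ U ≠ 0 := (hUo.measure_pos μ ⟨1, h1U⟩).ne'
  -- Lebesgue measure on a chart ball, transported to the group. Left translations by elements of U
  -- are close to the identity in the chart, so they change it by at most a factor 2 on subsets of
  -- U.
  set l : Measure G := (ν.restrict T).map e.symm with hl
  have hem : AEMeasurable e.symm (ν.restrict T) :=
    (e.continuousOn_symm.mono hRt).aemeasurable Metric.isOpen_ball.measurableSet
  have : IsFiniteMeasure (ν.restrict T) :=
    ⟨by rw [Measure.restrict_apply_univ]; exact measure_ball_lt_top⟩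
  have hlA : ∀ A ⊆ e.source ∩ e ⁻¹' T, MeasurableSet A → l A = ν (e '' A) := by
    intro A hA hAm
    rw [hl, Measure.map_apply_of_aemeasurable hem hAm,
      Measure.restrict_apply' Metric.isOpen_ball.measurableSet]
    congr 1
    ext v
    constructor
    · rintro ⟨hv, hvT⟩
      exact ⟨e.symm v, hv, e.right_inv (hRt hvT)⟩
    · rintro ⟨x, hx, rfl⟩
      refine ⟨?_, (hA hx).2⟩
      rw [mem_preimage, e.left_inv (hA hx).1]
      exact hx
  have hUsub : U ⊆ e.source ∩ e ⁻¹' T := fun x hx =>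
    ⟨(hUb x hx).1, (hssub (hUb x hx).2).2.1⟩
  have htrans : ∀ x ∈ U, ∀ A ⊆ U, MeasurableSet A →
      l {y | x⁻¹ * y ∈ A} ≤ 2 * l A ∧ 2⁻¹ * l A ≤ l {y | x⁻¹ * y ∈ A} := by
    intro x hx A hA hAm
    have hm : MeasurableSet {y | x⁻¹ * y ∈ A} := (measurable_const_mul x⁻¹) hAm
    have hsub : {y | x⁻¹ * y ∈ A} ⊆ e.source ∩ e ⁻¹' T := fun y hy => by
      simpa using hUT x hx _ (hA hy)
    have himg : e '' {y | x⁻¹ * y ∈ A} = (fun v => e (e.symm (e x) * e.symm v)) '' (e '' A) := by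
      rw [image_image, e.left_inv (hUb x hx).1]
      ext v
      constructor
      · rintro ⟨y, hy, rfl⟩
        exact ⟨x⁻¹ * y, hy, by simp [e.left_inv (hUb _ (hA hy)).1]⟩
      · rintro ⟨y, hy, rfl⟩
        exact ⟨x * y, by simpa using hy, by simp [e.left_inv (hUb _ (hA hy)).1]⟩
    have happ' : ApproximatesLinearOn (fun v => e (e.symm (e x) * e.symm v))
        (ContinuousLinearMap.id ℝ E) (e '' A) δ := by
      refine (happ (e x) (hssub (hUb x hx).2).1.1).mono_set ?_
      rintro _ ⟨y, hy, rfl⟩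
      exact (hssub (hUb y (hA hy)).2).1.1
    rw [hlA _ hsub hm, hlA A (hA.trans hUsub) hAm, himg]
    exact ⟨by simpa using hup _ _ happ', by simpa [ENNReal.coe_inv] using hlow _ _ happ'⟩
  -- Tonelli relates the measures l(xA), averaged over x in U, to the Haar measures of the sets
  -- yA⁻¹. For symmetric A these are yA, so left invariance suffices.
  have hfub : ∀ A : Set G, MeasurableSet A →
      ∫⁻ x in U, l {y | x⁻¹ * y ∈ A} ∂μ = ∫⁻ y, μ (U ∩ {x | x⁻¹ * y ∈ A}) ∂l := by
    intro A hA
    have hZ : MeasurableSet {z : G × G | z.1 ∈ U ∧ z.1⁻¹ * z.2 ∈ A} :=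
      (measurable_fst hUo.measurableSet).inter
        ((by fun_prop : Measurable fun z : G × G => z.1⁻¹ * z.2) hA)
    have h1 := Measure.prod_apply (μ := μ) (ν := l) hZ
    rw [Measure.prod_apply_symm hZ] at h1
    rw [← lintegral_indicator hUo.measurableSet]
    refine Eq.trans (lintegral_congr fun x => ?_) h1.symm
    by_cases hx : x ∈ U <;> simp [hx]
  obtain ⟨W₀, hW₀o, h1W₀, hW₀⟩ := exists_open_nhds_one_mul_subset (hUo.mem_nhds h1U)
  set W := W₀ ∩ U with hW
  have hWo : IsOpen W := hW₀o.inter hUo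
  have hlW0 : l W ≠ 0 := by
    rw [hlA W (inter_subset_right.trans hUsub) hWo.measurableSet]
    exact ((e.isOpen_image_of_subset_source hWo fun x hx => (hUb x hx.2).1).measure_pos ν
      ⟨e 1, 1, ⟨h1W₀, h1U⟩, rfl⟩).ne'
  refine ⟨W, hWo.mem_nhds ⟨h1W₀, h1U⟩, fun x hx => (hUb x hx.2).1, 2 * l univ / μ U,
    2 * μ U / l W, ENNReal.div_ne_top (ENNReal.mul_ne_top (by simp) (measure_ne_top l _)) hμU0,
    ENNReal.div_ne_top (ENNReal.mul_ne_top (by simp) hμU) hlW0, fun A hA hAm hAi => ?_⟩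
  have hAU : A ⊆ U := hA.trans inter_subset_right
  rw [← hlA A (hAU.trans hUsub) hAm]
  have hsymm : ∀ x y, x⁻¹ * y ∈ A ↔ y⁻¹ * x ∈ A := fun x y => by
    conv_rhs => rw [← hAi, Set.mem_inv]
    simp
  have hμA : ∀ y, μ {x | x⁻¹ * y ∈ A} = μ A := by
    intro y
    rw [← measure_preimage_mul μ y⁻¹ A]
    congr 1
    ext x
    exact hsymm x y
  constructor
  · have h1 : 2⁻¹ * l A * μ U ≤ μ A * l univ := by
      calc 2⁻¹ * l A * μ U = ∫⁻ x in U, 2⁻¹ * l A ∂μ := (setLIntegral_const _ _).symm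
        _ ≤ ∫⁻ x in U, l {y | x⁻¹ * y ∈ A} ∂μ :=
            setLIntegral_mono' hUo.measurableSet fun x hx => (htrans x hx A hAU hAm).2
        _ = ∫⁻ y, μ (U ∩ {x | x⁻¹ * y ∈ A}) ∂l := hfub A hAm
        _ ≤ ∫⁻ y, μ A ∂l := lintegral_mono fun y =>
            (measure_mono inter_subset_right).trans_eq (hμA y)
        _ = _ := lintegral_const _
    have h2 : l A * μ U ≤ 2 * l univ * μ A := by
      calc l A * μ U = 2 * (2⁻¹ * l A * μ U) := by
            rw [← mul_assoc, ← mul_assoc, ENNReal.mul_inv_cancel two_ne_zero ENNReal.ofNat_ne_top,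
              one_mul]
        _ ≤ 2 * (μ A * l univ) := by gcongr
        _ = _ := by ring
    rwa [ENNReal.mul_comm_div, mul_div_assoc',
      ENNReal.le_div_iff_mul_le (Or.inl hμU0) (Or.inl hμU)]
  · have h1 : μ A * l W ≤ 2 * l A * μ U := by
      calc μ A * l W = ∫⁻ y in W, μ A ∂l := (setLIntegral_const _ _).symm
        _ ≤ ∫⁻ y in W, μ (U ∩ {x | x⁻¹ * y ∈ A}) ∂l := by
            refine setLIntegral_mono' hWo.measurableSet fun y hy => ?_
            rw [← hμA y]
            refine measure_mono fun x hx => ⟨?_, hx⟩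
            have := hW₀ (mul_mem_mul hy.1 (hA ((hsymm x y).1 hx)).1)
            simpa using this
        _ ≤ ∫⁻ y, μ (U ∩ {x | x⁻¹ * y ∈ A}) ∂l := setLIntegral_le_lintegral _ _
        _ = ∫⁻ x in U, l {y | x⁻¹ * y ∈ A} ∂μ := (hfub A hAm).symm
        _ ≤ ∫⁻ x in U, 2 * l A ∂μ :=
            setLIntegral_mono' hUo.measurableSet fun x hx => (htrans x hx A hAU hAm).1
        _ = _ := setLIntegral_const _ _
    rw [ENNReal.mul_comm_div, mul_div_assoc', ENNReal.le_div_iff_mul_le (Or.inl hlW0)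
      (Or.inl (measure_ne_top l _))]
    calc _ ≤ _ := h1
      _ = _ := by ring

/-- The factor by which an automorphism scales Haar measure is the determinant of its differential
at `1`, read in a chart. -/
lemma haar_factor_eq_det (μ : Measure G) [μ.IsHaarMeasure] (ν : Measure E)
    [ν.IsAddHaarMeasure] (e : OpenPartialHomeomorph G E) (he : (1 : G) ∈ e.source)
    {F' : E × E →L[ℝ] E}
    (hF : HasStrictFDerivAt (fun z : E × E => e (e.symm z.1 * e.symm z.2)) F' (e 1, e 1))
    {φ : G → G} {D : E →L[ℝ] E} (hD : HasStrictFDerivAt (fun v => e (φ (e.symm v))) D (e 1))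
    {κ : ℝ≥0} (hκ0 : κ ≠ 0) (hκ : ∀ A, μ (φ '' A) = κ * μ A) {A : ℕ → Set G}
    (hAφ : ∀ k, A (k + 1) = φ '' A k) (hAm : ∀ k, MeasurableSet (A k)) (hAi : ∀ k, (A k)⁻¹ = A k)
    (hA : ∀ N ∈ 𝓝 (1 : G), ∀ᶠ k in atTop, A k ⊆ N) (hA0 : μ (A 0) ≠ 0) (hAt : μ (A 0) ≠ ⊤) :
    (κ : ℝ≥0∞) = ENNReal.ofReal |D.det| := by
  obtain ⟨W, hW, hWs, c₁, c₂, hc₁, hc₂, hcomp⟩ := exists_measure_chart_comparable μ ν e he hF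
  have hpow : ∀ k j, μ (A (k + j)) = κ ^ j * μ (A k) := by
    intro k j
    induction j with
    | zero => simp
    | succ j ih => rw [← add_assoc, hAφ, hκ, ih, pow_succ']; ring
  have hAk : ∀ k, μ (A k) ≠ 0 ∧ μ (A k) ≠ ⊤ := by
    intro k
    have := hpow 0 k
    rw [zero_add] at this
    rw [this]
    exact ⟨mul_ne_zero (pow_ne_zero _ (by simpa using hκ0)) hA0,
      ENNReal.mul_ne_top (ENNReal.pow_ne_top ENNReal.coe_ne_top) hAt⟩
  have himg : ∀ k, A k ⊆ W → e '' A (k + 1) = (fun v => e (φ (e.symm v))) '' (e '' A k) := by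
    intro k hk
    rw [hAφ, image_image, image_image]
    exact image_congr fun x hx => by rw [e.left_inv (hWs (hk hx))]
  have hnear : ∀ δ : ℝ≥0, 0 < δ → ∃ k, ∀ j, A (k + j) ⊆ W ∧
      ApproximatesLinearOn (fun v => e (φ (e.symm v))) D (e '' A (k + j)) δ := by
    intro δ hδ
    obtain ⟨s, hs, happ⟩ := hD.approximates_deriv_on_nhds (Or.inr hδ)
    obtain ⟨k, hk⟩ := eventually_atTop.1
      (hA _ (inter_mem hW ((e.continuousAt he).preimage_mem_nhds hs)))
    refine ⟨k, fun j => ⟨(hk _ (Nat.le_add_right k j)).trans inter_subset_left,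
      happ.mono_set ?_⟩⟩
    rintro _ ⟨x, hx, rfl⟩
    exact (hk _ (Nat.le_add_right k j) hx).2
  -- For m on either side of |det D|, Lebesgue measure of the shrinking images changes by at most,
  -- or at least, a factor m per step, while Haar measure changes by exactly κ. Comparability over j
  -- steps gives κ^j ≤ C m^j, respectively m^j ≤ C κ^j.
  refine le_antisymm (le_of_forall_gt_imp_ge_of_dense fun m hm => ?_)
    (le_of_forall_lt_imp_le_of_dense fun m hm => ?_)
  · rcases eq_or_ne m ⊤ with rfl | hmt
    · exact le_top
    lift m to ℝ≥0 using hmt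
    obtain ⟨δ, hup, hδ⟩ := ((addHaar_image_le_mul_of_det_lt ν D hm).and self_mem_nhdsWithin).exists
    obtain ⟨k, hk⟩ := hnear δ hδ
    have hν : ∀ j, ν (e '' A (k + j)) ≤ m ^ j * ν (e '' A k) := by
      intro j
      induction j with
      | zero => simp
      | succ j ih =>
        rw [← add_assoc, himg _ (hk j).1]
        calc _ ≤ m * ν (e '' A (k + j)) := hup _ _ (hk j).2
          _ ≤ m * (m ^ j * ν (e '' A k)) := by gcongr
          _ = _ := by rw [pow_succ']; ring
    have hνk : ν (e '' A k) ≠ ⊤ := ((hcomp _ (hk 0).1 (hAm _) (hAi _)).1.trans_lt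
      (ENNReal.mul_lt_top hc₁.lt_top (hAk k).2.lt_top)).ne
    set C := c₂ * ν (e '' A k) / μ (A k) with hC
    have hCt : C ≠ ⊤ := ENNReal.div_ne_top (ENNReal.mul_ne_top hc₂ hνk) (hAk k).1
    refine ENNReal.coe_le_coe.2 (NNReal.le_of_forall_pow_le_const_mul (C := C.toNNReal) fun j => ?_)
    rw [← ENNReal.coe_le_coe]
    push_cast
    rw [ENNReal.coe_toNNReal hCt, hC, ENNReal.mul_comm_div, mul_div_assoc',
      ENNReal.le_div_iff_mul_le (Or.inl (hAk k).1) (Or.inl (hAk k).2), ← hpow]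
    calc _ ≤ c₂ * ν (e '' A (k + j)) := (hcomp _ (hk j).1 (hAm _) (hAi _)).2
      _ ≤ c₂ * (m ^ j * ν (e '' A k)) := by gcongr; exact hν j
      _ = _ := by ring
  · lift m to ℝ≥0 using (hm.trans_le le_top).ne
    obtain ⟨δ, hlow, hδ⟩ := ((mul_le_addHaar_image_of_lt_det ν D hm).and self_mem_nhdsWithin).exists
    obtain ⟨k, hk⟩ := hnear δ hδ
    have hν : ∀ j, m ^ j * ν (e '' A k) ≤ ν (e '' A (k + j)) := by
      intro j
      induction j with
      | zero => simp
      | succ j ih =>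
        rw [← add_assoc, himg _ (hk j).1]
        calc _ = m * (m ^ j * ν (e '' A k)) := by rw [pow_succ']; ring
          _ ≤ m * ν (e '' A (k + j)) := by gcongr
          _ ≤ _ := hlow _ _ (hk j).2
    have hνk : ν (e '' A k) ≠ ⊤ := ((hcomp _ (hk 0).1 (hAm _) (hAi _)).1.trans_lt
      (ENNReal.mul_lt_top hc₁.lt_top (hAk k).2.lt_top)).ne
    have hνk0 : ν (e '' A k) ≠ 0 := fun h0 => by
      have := (hcomp _ (hk 0).1 (hAm _) (hAi _)).2
      rw [add_zero, h0, mul_zero] at this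
      exact (hAk k).1 (le_antisymm this zero_le)
    set C := c₁ * μ (A k) / ν (e '' A k) with hC
    have hCt : C ≠ ⊤ := ENNReal.div_ne_top (ENNReal.mul_ne_top hc₁ (hAk k).2) hνk0
    refine ENNReal.coe_le_coe.2 (NNReal.le_of_forall_pow_le_const_mul (C := C.toNNReal) fun j => ?_)
    rw [← ENNReal.coe_le_coe]
    push_cast
    rw [ENNReal.coe_toNNReal hCt, hC, ENNReal.mul_comm_div, mul_div_assoc',
      ENNReal.le_div_iff_mul_le (Or.inl hνk0) (Or.inl hνk)]
    calc _ ≤ ν (e '' A (k + j)) := hν j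
      _ ≤ c₁ * μ (A (k + j)) := (hcomp _ (hk j).1 (hAm _) (hAi _)).1
      _ = _ := by rw [hpow]; ring

end HaarChart

/-- The push-forward of μ under the inverse of φ is again a Haar measure, and Haar measure is unique
up to a scalar. -/
lemma exists_haar_factor {G : Type*} [TopologicalSpace G] [Group G] [IsTopologicalGroup G]
    [LocallyCompactSpace G] [SecondCountableTopology G] [MeasurableSpace G] [BorelSpace G]
    (μ : Measure G) [μ.IsHaarMeasure] (φ : G ≃* G) (hφ : Continuous φ) (hφ' : Continuous φ.symm) :
    ∃ κ : ℝ≥0, κ ≠ 0 ∧ ∀ A, μ (φ '' A) = κ * μ A := by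
  have hH : (μ.map φ.symm).IsHaarMeasure := φ.symm.isHaarMeasure_map μ hφ' hφ
  refine ⟨Measure.haarScalarFactor (μ.map φ.symm) μ,
    (Measure.haarScalarFactor_pos_of_isHaarMeasure _ _).ne', fun A => ?_⟩
  let ψ : G ≃ₜ G := { φ.symm.toEquiv with continuous_toFun := hφ', continuous_invFun := hφ }
  have h1 : μ.map φ.symm A = μ (φ '' A) := by
    have : φ '' A = φ.symm ⁻¹' A := φ.toEquiv.image_eq_preimage_symm A
    rw [this]
    exact ψ.toMeasurableEquiv.map_apply A
  rw [← h1]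
  conv_lhs => rw [Measure.isMulLeftInvariant_eq_smul (μ.map φ.symm) μ]
  rfl

/-! ### Group dilations and multiplication in the chart at the identity. -/

section Dilation

variable {n : ℕ} {G : Type*} [TopologicalSpace G] [ChartedSpace (EuclideanSpace ℝ (Fin n)) G]
  [Group G] [LieGroup (𝓡 n) ∞ G]

/-- The layers of a stratification, in the model space. -/
def modelLayer (S : LieStratification (GroupLieAlgebra (𝓡 n) G)) :
    ℕ → Submodule ℝ (EuclideanSpace ℝ (Fin n)) := S.layer

/-- Since φ fixes 1, source and target use the same chart, and the manifold derivative is the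
Fréchet derivative there. Smoothness makes it strict, as the linearization arguments require. -/
lemma IsGroupDilation.exists_hasStrictFDerivAt
    {S : LieStratification (GroupLieAlgebra (𝓡 n) G)} {r : ℝ} {φ : G ≃* G}
    (h : IsGroupDilation S r φ) :
    ∃ D : EuclideanSpace ℝ (Fin n) →L[ℝ] EuclideanSpace ℝ (Fin n),
      (∀ k, ∀ X ∈ modelLayer S k, D X = r ^ k • X) ∧
      HasStrictFDerivAt (fun v => chartAt (EuclideanSpace ℝ (Fin n)) (1 : G)
        (φ ((chartAt (EuclideanSpace ℝ (Fin n)) (1 : G)).symm v))) D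
        (chartAt (EuclideanSpace ℝ (Fin n)) (1 : G) 1) := by
  obtain ⟨hφ, hlayer⟩ := h
  have h1 := (contMDiffAt_iff.1 (hφ 1)).2
  have h2 := (hφ.mdifferentiable (by simp) 1).mfderiv
  simp only [mfld_simps] at h1 h2
  rw [fderivWithin_univ] at h2
  rw [contDiffWithinAt_univ] at h1
  refine ⟨fderiv ℝ (chartAt (EuclideanSpace ℝ (Fin n)) (φ 1) ∘ φ ∘
    (chartAt (EuclideanSpace ℝ (Fin n)) (1 : G)).symm)
      (chartAt (EuclideanSpace ℝ (Fin n)) (1 : G) 1), fun k X hX => ?_, ?_⟩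
  · have h3 := hlayer k X hX
    rw [h2] at h3
    exact h3
  · have h3 := h1.hasStrictFDerivAt (by simp)
    simp only [map_one] at h3 ⊢
    exact h3

variable (G) in
lemma exists_hasStrictFDerivAt_mul_chart :
    ∃ F' : EuclideanSpace ℝ (Fin n) × EuclideanSpace ℝ (Fin n) →L[ℝ] EuclideanSpace ℝ (Fin n),
      HasStrictFDerivAt (fun z : EuclideanSpace ℝ (Fin n) × EuclideanSpace ℝ (Fin n) =>
        chartAt (EuclideanSpace ℝ (Fin n)) (1 : G)
          ((chartAt (EuclideanSpace ℝ (Fin n)) (1 : G)).symm z.1 *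
            (chartAt (EuclideanSpace ℝ (Fin n)) (1 : G)).symm z.2)) F'
        (chartAt (EuclideanSpace ℝ (Fin n)) (1 : G) 1,
          chartAt (EuclideanSpace ℝ (Fin n)) (1 : G) 1) := by
  set e := chartAt (EuclideanSpace ℝ (Fin n)) (1 : G) with he
  have h1 : (1 : G) ∈ e.source := mem_chart_source _ _
  have hM : IsManifold (𝓡 n) ∞ G := LieGroup.toContMDiffMul.toIsManifold
  have hsymm : ContMDiffAt (𝓡 n) (𝓡 n) ∞ e.symm (e 1) :=
    contMDiffOn_chart_symm.contMDiffAt (e.open_target.mem_nhds (e.map_source h1))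
  have hfst : ContMDiffAt 𝓘(ℝ, EuclideanSpace ℝ (Fin n) × EuclideanSpace ℝ (Fin n)) (𝓡 n) ∞
      (fun z : EuclideanSpace ℝ (Fin n) × EuclideanSpace ℝ (Fin n) => e.symm z.1) (e 1, e 1) :=
    ContMDiffAt.comp (I' := 𝓡 n) (e 1, e 1) hsymm contDiff_fst.contMDiff.contMDiffAt
  have hsnd : ContMDiffAt 𝓘(ℝ, EuclideanSpace ℝ (Fin n) × EuclideanSpace ℝ (Fin n)) (𝓡 n) ∞
      (fun z : EuclideanSpace ℝ (Fin n) × EuclideanSpace ℝ (Fin n) => e.symm z.2) (e 1, e 1) :=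
    ContMDiffAt.comp (I' := 𝓡 n) (e 1, e 1) hsymm contDiff_snd.contMDiff.contMDiffAt
  have hmul := hfst.mul hsnd
  have hchart : ContMDiffAt (𝓡 n) (𝓡 n) ∞ e (e.symm (e 1) * e.symm (e 1)) := by
    rw [e.left_inv h1, mul_one]
    exact contMDiffAt_of_mem_maximalAtlas (IsManifold.chart_mem_maximalAtlas 1) h1
  have hcomp := ContMDiffAt.comp (e 1, e 1) hchart hmul
  exact ⟨_, (contMDiffAt_iff_contDiffAt.1 hcomp).hasStrictFDerivAt (by simp)⟩

end Dilation

/-! ### From homogeneous norms to quasi-norms with exact volume growth. -/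

/-- A homogeneous norm on a stratified group is a symmetric quasi-norm whose balls of radius `r`
have measure `c r ^ Q`, where `Q` is the homogeneous dimension. -/
theorem IsHomogeneousNorm.exists_isAhlforsNorm {n : ℕ} {G : Type*} [TopologicalSpace G] [T2Space G]
    [SecondCountableTopology G] [ChartedSpace (EuclideanSpace ℝ (Fin n)) G] [Group G]
    [LieGroup (𝓡 n) ∞ G] [IsTopologicalGroup G] [PreconnectedSpace G] [MeasurableSpace G]
    [BorelSpace G] {S : LieStratification (GroupLieAlgebra (𝓡 n) G)} {ρ : G → ℝ}
    (hρ : IsHomogeneousNorm S ρ) (μ : Measure G) [μ.IsHaarMeasure] (hQ : 0 < S.homDim) :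
    ∃ K c : ℝ, IsAhlforsNorm μ ρ S.homDim K c := by
  have : LocallyCompactSpace G := Manifold.locallyCompact_of_finiteDimensional (𝓡 n)
  set e := chartAt (EuclideanSpace ℝ (Fin n)) (1 : G) with he
  have h1e : (1 : G) ∈ e.source := mem_chart_source _ _
  obtain ⟨F', hF⟩ := exists_hasStrictFDerivAt_mul_chart (n := n) G
  have hVi : DirectSum.IsInternal (modelLayer S) := S.isInternal
  have hVb : ∀ j, j ∉ Finset.Icc 1 S.step → modelLayer S j = ⊥ := S.layer_eq_bot
  have hρ1 : ρ 1 = 0 := (hρ.eq_zero_iff 1).2 rfl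
  have hpos : ∀ x, x ≠ 1 → 0 < ρ x := fun x hx =>
    (hρ.nonneg x).lt_of_ne fun h => hx ((hρ.eq_zero_iff x).1 h.symm)
  have hdil : ∀ r : ℝ, 0 < r → ∃ φ : G ≃* G, IsGroupDilation S r φ ∧ Continuous φ ∧
      IsOpenMap φ ∧ Continuous φ.symm ∧ ∀ x, ρ (φ x) = r * ρ x := by
    intro r hr
    obtain ⟨φ, hφ, hφρ⟩ := hρ.dilation r hr
    have hc : Continuous φ := hφ.1.continuous
    -- The inverse of a dilation is not assumed continuous; the open mapping theorem for σ-compact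
    -- groups provides this.
    have ho : IsOpenMap φ := MonoidHom.isOpenMap_of_sigmaCompact φ.toMonoidHom φ.surjective hc
    exact ⟨φ, hφ, hc, ho, (φ.toEquiv.toHomeomorphOfContinuousOpen hc ho).symm.continuous, hφρ⟩
  obtain ⟨a, ha, K₀, hK₀, haK⟩ : ∃ a : ℝ, 0 < a ∧ ∃ K₀ : Set G, IsCompact K₀ ∧
      ∀ x, ρ x < a → x ∈ K₀ := by
    obtain ⟨C, hC, hnorm⟩ := exists_norm_dilation_le hVi hVb
    -- This ratio makes the differential at 1 have norm at most C/(4C+1) ≤ 1/4.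
    have hr0 : 0 < 1 / (4 * C + 1) := by positivity
    have hr1 : 1 / (4 * C + 1) ≤ 1 := (div_le_one (by positivity)).2 (by linarith)
    obtain ⟨φ, hφ, hc, ho, -, hφρ⟩ := hdil _ hr0
    obtain ⟨D, hD, hDs⟩ := hφ.exists_hasStrictFDerivAt
    have hD4 : ‖D‖ ≤ 1 / 4 := by
      refine (hnorm _ hr0.le hr1 D hD).trans ?_
      rw [mul_one_div, div_le_div_iff₀ (by positivity) (by norm_num)]
      linarith
    obtain ⟨K₀, U, hK₀, hU, h1U, hUK, hlim⟩ :=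
      exists_contracting_nhds e h1e φ.toMonoidHom hc hDs hD4
    obtain ⟨a, ha, haK⟩ := exists_sublevel_subset ho hK₀ hU h1U hUK hlim hρ.continuous hpos
      fun x => by rw [hφρ]; exact mul_le_of_le_one_left (hρ.nonneg x) hr1
    exact ⟨a, ha, K₀, hK₀, haK⟩
  have hcompact : ∀ R, IsCompact {x | ρ x ≤ R} := by
    intro R
    have ht : 0 < a / (|R| + 1) := by positivity
    obtain ⟨φ, -, hc, -, hc', hφρ⟩ := hdil _ ht
    refine (hK₀.image hc').of_isClosed_subset (isClosed_le hρ.continuous continuous_const) ?_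
    intro x hx
    refine ⟨φ x, haK _ ?_, φ.symm_apply_apply x⟩
    have hxR : ρ x < |R| + 1 := by
      have : ρ x ≤ R := hx
      linarith [le_abs_self R]
    rw [hφρ, div_mul_eq_mul_div, div_lt_iff₀ (by positivity)]
    gcongr
  obtain ⟨K, hK1, hK⟩ : ∃ K : ℝ, 1 ≤ K ∧ ∀ x y, ρ (x * y) ≤ K * max (ρ x) (ρ y) := by
    -- The constant is a bound for ρ(xy) on the compact unit ball squared; a dilation by the inverse
    -- of max(ρ x, ρ y) reduces to that case.
    obtain ⟨M, hM⟩ := (((hcompact 1).prod (hcompact 1)).bddAbove_image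
      (f := fun z : G × G => ρ (z.1 * z.2)) (hρ.continuous.comp continuous_mul).continuousOn)
    refine ⟨max M 1, le_max_right _ _, fun x y => ?_⟩
    rcases (le_max_of_le_left (hρ.nonneg x) : 0 ≤ max (ρ x) (ρ y)).eq_or_lt with h0 | h0
    · have hx : x = 1 := (hρ.eq_zero_iff x).1
        (le_antisymm ((le_max_left _ _).trans h0.ge) (hρ.nonneg x))
      have hy : y = 1 := (hρ.eq_zero_iff y).1
        (le_antisymm ((le_max_right _ _).trans h0.ge) (hρ.nonneg y))
      simp [hx, hy, hρ1]
    · set t := max (ρ x) (ρ y) with ht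
      obtain ⟨φ, -, -, -, -, hφρ⟩ := hdil t⁻¹ (inv_pos.2 h0)
      have hle : ∀ z, ρ z ≤ t → ρ (φ z) ≤ 1 := fun z hz => by
        rw [hφρ, inv_mul_le_iff₀ h0, mul_one]; exact hz
      have hmem := hM ⟨(φ x, φ y), ⟨hle x (le_max_left _ _), hle y (le_max_right _ _)⟩, rfl⟩
      simp only at hmem
      rw [← map_mul, hφρ, inv_mul_le_iff₀ h0] at hmem
      rw [mul_comm]
      exact hmem.trans (mul_le_mul_of_nonneg_left (le_max_left _ _) h0.le)
  have hsymm : ∀ x y, ρ (x⁻¹ * y) = ρ (y⁻¹ * x) := fun x y => by rw [← hρ.inv]; simp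
  have hball1 : ∀ r, gBall ρ (1 : G) r = {x | ρ x < r} := fun r => by
    ext x
    rw [mem_gBall, mul_one, hρ.inv]; rfl
  have hopen : ∀ r, IsOpen (gBall ρ (1 : G) r) := fun r => by
    rw [hball1]; exact isOpen_lt hρ.continuous continuous_const
  have hmpos : ∀ r, 0 < r → μ (gBall ρ (1 : G) r) ≠ 0 := fun r hr =>
    ((hopen r).measure_pos μ ⟨1, by rw [hball1]; simpa [hρ1] using hr⟩).ne'
  have hmtop : ∀ r, μ (gBall ρ (1 : G) r) ≠ ⊤ := fun r => by
    rw [hball1]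
    exact ((measure_mono fun x (hx : ρ x < r) => hx.le).trans_lt
      (hcompact r).measure_lt_top).ne
  have himage : ∀ (r : ℝ) (φ : G ≃* G), 0 < r → (∀ x, ρ (φ x) = r * ρ x) → ∀ t,
      φ '' gBall ρ 1 t = gBall ρ 1 (r * t) := by
    intro r φ hr hφρ t
    rw [hball1, hball1]
    ext x
    constructor
    · rintro ⟨y, hy, rfl⟩
      show ρ (φ y) < r * t
      rw [hφρ]
      exact mul_lt_mul_of_pos_left hy hr
    · intro hx
      refine ⟨φ.symm x, ?_, φ.apply_symm_apply x⟩
      have h2 : ρ (φ (φ.symm x)) < r * t := by rw [φ.apply_symm_apply]; exact hx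
      rw [hφρ] at h2
      exact lt_of_mul_lt_mul_left h2 hr.le
  have hsmall : ∀ N ∈ 𝓝 (1 : G), ∃ r, 0 < r ∧ gBall ρ 1 r ⊆ N := by
    intro N hN
    obtain ⟨N', hN', hNo, h1N⟩ := mem_nhds_iff.1 hN
    obtain ⟨r, hr, hrN⟩ := ((hcompact 1).diff hNo).exists_forall_le' hρ.continuous.continuousOn
      (a := 0) fun x hx => hpos x fun h => hx.2 (h ▸ h1N)
    refine ⟨min r 1, by positivity, fun x hx => hN' ?_⟩
    rw [hball1] at hx
    by_contra hxN
    have h2 : ρ x < min r 1 := hx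
    have h3 := hrN x ⟨(h2.trans_le (min_le_right _ _)).le, hxN⟩
    exact absurd (h2.trans_le (min_le_left _ _)) (not_lt.2 h3)
  -- For r < 1 the dilated balls shrink to 1, as `haar_factor_eq_det` demands. Radii above 1 are
  -- handled below through r⁻¹.
  have hshrink : ∀ r, 0 < r → r < 1 → ∀ t, 0 < t →
      μ (gBall ρ 1 (r * t)) = ENNReal.ofReal (r ^ S.homDim) * μ (gBall ρ 1 t) := by
    intro r hr hr1 t ht
    obtain ⟨φ, hφ, hc, ho, hc', hφρ⟩ := hdil r hr
    obtain ⟨D, hD, hDs⟩ := hφ.exists_hasStrictFDerivAt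
    obtain ⟨κ, hκ0, hκ⟩ := exists_haar_factor μ φ hc hc'
    have hdet : D.det = r ^ S.homDim := det_dilation hVi hVb (D := D) hD
    have hfac := haar_factor_eq_det μ volume e h1e hF hDs hκ0 hκ
      (A := fun k => gBall ρ 1 (r ^ k * t))
      (fun k => by rw [himage r φ hr hφρ, ← mul_assoc, pow_succ'])
      (fun k => (hopen _).measurableSet)
      (fun k => by
        ext x
        rw [hball1, Set.mem_inv]
        show ρ x⁻¹ < _ ↔ ρ x < _
        rw [hρ.inv])
      (fun N hN => by
        obtain ⟨s, hs, hsN⟩ := hsmall N hN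
        have hlim : Tendsto (fun k : ℕ => r ^ k * t) atTop (𝓝 0) := by
          simpa using (tendsto_pow_atTop_nhds_zero_of_lt_one hr.le hr1).mul_const t
        filter_upwards [hlim.eventually_le_const hs] with k hk
        exact (gBall_mono hk).trans hsN)
      (by simpa using hmpos t ht) (by simpa using hmtop t)
    rw [← himage r φ hr hφρ, hκ, hfac, hdet, abs_of_pos (by positivity)]
  set c := (μ (gBall ρ (1 : G) 1)).toReal with hc
  have hc0 : 0 < c := ENNReal.toReal_pos (hmpos 1 one_pos) (hmtop 1)
  have hcV : μ (gBall ρ (1 : G) 1) = ENNReal.ofReal c := (ENNReal.ofReal_toReal (hmtop 1)).symm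
  refine ⟨K, c, ⟨hρ.continuous, hρ.nonneg, hρ.eq_zero_iff, hρ.inv, by exact_mod_cast hQ, hK1, hK,
    hc0, fun x r hr => ?_, fun x r => ?_⟩⟩
  · have htrans : μ (gBall ρ x r) = μ (gBall ρ 1 r) := by
      rw [← measure_preimage_mul μ x⁻¹ (gBall ρ 1 r)]
      congr 1
      ext y
      rw [mem_preimage, mem_gBall, hball1, hsymm]
      rfl
    rw [htrans, Real.rpow_natCast]
    rcases lt_trichotomy r 1 with h | rfl | h
    · have := hshrink r hr h 1 one_pos
      rw [mul_one, hcV] at this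
      rw [this, ← ENNReal.ofReal_mul (by positivity), mul_comm]
    · rw [hcV]; simp
    · have := hshrink r⁻¹ (inv_pos.2 hr) (inv_lt_one_of_one_lt₀ h) r hr
      rw [inv_mul_cancel₀ hr.ne', hcV] at this
      rw [mul_comm, ENNReal.ofReal_mul (by positivity), this, ← mul_assoc,
        ← ENNReal.ofReal_mul (by positivity), ← mul_pow, mul_inv_cancel₀ hr.ne', one_pow,
        ENNReal.ofReal_one, one_mul]
  · refine ⟨(fun z => x * z⁻¹) '' {z | ρ z ≤ r}, (hcompact r).image (by fun_prop), fun y hy => ?_⟩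
    exact ⟨y⁻¹ * x, (mem_gBall.1 hy).le, by simp⟩

end

theorem theorem1p2 {n : ℕ} {G : Type*} [TopologicalSpace G] [T2Space G] [SecondCountableTopology G]
    [ChartedSpace (EuclideanSpace ℝ (Fin n)) G] [Group G] [LieGroup (𝓡 n) ∞ G]
    [SimplyConnectedSpace G] [MeasurableSpace G] [BorelSpace G]
    (S : LieStratification (GroupLieAlgebra (𝓡 n) G))
    (ρ : G → ℝ) (hρ : IsHomogeneousNorm S ρ)
    (μ : Measure G) [μ.IsHaarMeasure]
    (Q α β : ℝ) (hQ : Q = S.homDim) (hβ : 0 < β) (hβ1 : β < 1) (hα : 0 < α) (hαQ : α < Q)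
    (hαβ : 0 < α + β) (hαβQ : α + β < Q)
    (b : G → ℝ) (hb : LocallyIntegrable b μ) :
    List.TFAE [
      (∃ b' : G → ℝ, b =ᵐ[μ] b' ∧ MemLip ρ β b' ∧ ∀ x, 0 ≤ b' x),
      (∀ p q : ℝ, 1 < p → p < Q / (α + β) → 1 / q = 1 / p - (α + β) / Q →
        CommutatorBounded μ ρ Q α b p q),
      (∃ p q : ℝ, 1 < p ∧ p < Q / (α + β) ∧ 1 / q = 1 / p - (α + β) / Q ∧
        CommutatorBounded μ ρ Q α b p q),
      (∃ s : ℝ, 1 ≤ s ∧ OscillationCondition μ ρ Q α β s b),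
      (∀ s : ℝ, 1 ≤ s → OscillationCondition μ ρ Q α β s b)] := by
  have : IsTopologicalGroup G := topologicalGroup_of_lieGroup (𝓡 n) ∞
  have : LocallyCompactSpace G := Manifold.locallyCompact_of_finiteDimensional (𝓡 n)
  have hQ0 : 0 < S.homDim := by
    have : (0 : ℝ) < S.homDim := by rw [← hQ]; linarith
    exact_mod_cast this
  obtain ⟨K, c, h⟩ := hρ.exists_isAhlforsNorm μ hQ0
  rw [← hQ] at h
  exact h.tfae_memLip_commutatorBounded_oscillationCondition hα hβ hαβQ hb
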